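/- Let $1<p<\infty$. There are constants $C_p,c_p>0$ depending only on $p$ such that the following holds for every (non-archimedean) local field $K$, that is, every non-discrete totally disconnected locally compact field. Let $dx$ be a Haar measure on the additive group of $K$, write $|E|$ for the measure of a set $E$, let $|x|$ be the normalized absolute value on $K$ (so $|0|=0$ and $d(\alpha x)=|\alpha|\,dx$ for $\alpha\neq0$), and let $\mathfrak D=\{x\in K:|x|\le 1\}$ be the ring of integers. The balls of $K$ are the sets $h+a\mathfrak D$ with $h,a\in K$, $a\ne0$. A weight is a locally integrable function $w:K\to\mathbb R$ that is positive almost everywhere; $L^p(w)$ is the space of complex-valued functions on $K$ that are $p$-integrable with respect to $w(x)\,dx$. We write $w\in A_p$ if $w$ is a weight and there is a finite $C$ with $$\Bigl(\frac1{|B|}\int_B w\,dx\Bigr)\Bigl(\frac1{|B|}\int_B w^{-\frac1{p-1}}\,dx\Bigr)^{p-1}\le C\quad\text{for every ball }B,$$ and $[w]_{A_p}$ denotes the infimum of all such $C$. The Hardy–Littlewood maximal function is $Mf(x)=\sup_{B\ni x}\frac1{|B|}\int_B|f(y)|\,dy$, the supremum being over all balls $B$ containing $x$, and $\|M\|_{L^p(w)\to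 L^p(w)}$ is the infimum of all $N\in[0,\infty]$ with $\|Mf\|_{L^p(w)}\le N\|f\|_{L^p(w)}$ for all $f\in L^p(w)$. (1) If $w\in A_p$, then every $f\in L^p(w)$ is locally integrable, $Mf\in L^p(w)$, and $$\|M\|_{L^p(w)\to L^p(w)}\le C_p\,[w]_{A_p}^{\frac1{p-1}}.$$ (2) The power $\frac1{p-1}$ is best possible. For $0<\theta<1$ put $w_\theta(x)=|x|^{(p-1)(1-\theta)}$ and $f_\theta(x)=|x|^{\theta-1}\mathbf 1_{\mathfrak D}(x)$. Then $w_\theta\in A_p$, $f_\theta\in L^p(w_\theta)$, $\|f_\theta\|_{L^p(w_\theta)}>0$, $$\|Mf_\theta\|_{L^p(w_\theta)}\ge c_p\,[w_\theta]_{A_p}^{\frac1{p-1}}\,\|f_\theta\|_{L^p(w_\theta)},\qquad\text{so}\qquad \|M\|_{L^p(w_\theta)\to L^p(w_\theta)}\ge c_p\,[w_\theta]_{A_p}^{\frac1{p-1}},$$ and $[w_\theta]_{A_p}\to\infty$ as $\theta\to0^+$. Consequently, for no $\beta<\frac1{p-1}$ is there a finite constant $C'$ with $\|M\|_{L^p(w)\to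 L^p(w)}\le C'[w]_{A_p}^{\beta}$ for all $w\in A_p$. -/

import Mathlib

open MeasureTheory Filter Topology
open scoped ENNReal NNReal ValuativeRel

namespace LocalFieldWeights

section

variable {K : Type*} [Field K] [ValuativeRel K] [TopologicalSpace K]

/-- The normalized absolute value of a local field: `|0| = 0`, and for `α ≠ 0` the number `|α|` is
the factor by which multiplication by `α` scales every additive Haar measure, `d(αx) = |α| dx`. -/
noncomputable def absV [IsNonarchimedeanLocalField K] (x : K) : ℝ :=
  open Classical in
  if hx : x = 0 then 0 else (distribHaarChar K (Units.mk0 x hx) : ℝ)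

/-- The balls of `K`: the sets `h + a𝔇` with `h ∈ K`, `a ∈ K`, `a ≠ 0`, where `𝔇` is the ring of
integers. These are the sets `h + 𝔓ᵏ`, `k ∈ ℤ`. -/
def IsBall (B : Set K) : Prop :=
  ∃ h a : K, a ≠ 0 ∧
    B = {y | ValuativeRel.valuation K (y - h) ≤ ValuativeRel.valuation K a}

variable [MeasurableSpace K]

/-- The Hardy–Littlewood maximal function
`Mf(x) = sup_{B ∋ x} |B|⁻¹ ∫_B |f|`, the supremum being over all balls `B` containing `x`. -/
noncomputable def maximalFn (μ : Measure K) (f : K → ℂ) (x : K) : ℝ≥0∞ :=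
  ⨆ (B : Set K) (_ : IsBall B) (_ : x ∈ B), (μ B)⁻¹ * ∫⁻ y in B, ‖f y‖ₑ ∂μ

/-- A weight: a locally integrable function that is positive almost everywhere. -/
structure IsWeight (μ : Measure K) (w : K → ℝ) : Prop where
  locallyIntegrable : LocallyIntegrable w μ
  pos : ∀ᵐ x ∂μ, 0 < w x

/-- The measure `w(x) dx`. -/
noncomputable def weighted (μ : Measure K) (w : K → ℝ) : Measure K :=
  μ.withDensity fun x => ENNReal.ofReal (w x)

/-- The expression
`(|B|⁻¹ ∫_B w) * (|B|⁻¹ ∫_B w^(-1/(p-1)))^(p-1)`; the integrals take values in `[0, ∞]`. -/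
noncomputable def apQuantity (μ : Measure K) (p : ℝ) (w : K → ℝ) (B : Set K) : ℝ≥0∞ :=
  ((μ B)⁻¹ * ∫⁻ x in B, ENNReal.ofReal (w x) ∂μ) *
    ((μ B)⁻¹ * ∫⁻ x in B, ENNReal.ofReal (w x ^ (-(1 / (p - 1)))) ∂μ) ^ (p - 1)

/-- The Muckenhoupt class `A_p`. -/
def IsAp (μ : Measure K) (p : ℝ) (w : K → ℝ) : Prop :=
  IsWeight μ w ∧ ∃ C : ℝ≥0, 0 < C ∧ ∀ B : Set K, IsBall B → apQuantity μ p w B ≤ C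

/-- The `A_p` characteristic `[w]_{A_p}`: the infimum of all admissible constants. -/
noncomputable def apChar (μ : Measure K) (p : ℝ) (w : K → ℝ) : ℝ≥0∞ :=
  sInf {C : ℝ≥0∞ | ∀ B : Set K, IsBall B → apQuantity μ p w B ≤ C}

/-- The `L^p(w)` (quasi-)norm for complex-valued or `[0, ∞]`-valued functions. -/
noncomputable def weightedNorm {E : Type*} [ENorm E] (μ : Measure K) (p : ℝ) (w : K → ℝ)
    (f : K → E) : ℝ≥0∞ :=
  eLpNorm f (ENNReal.ofReal p) (weighted μ w)

/-- Membership in `L^p(w)`. -/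
def MemWeighted {E : Type*} [TopologicalSpace E] [ContinuousENorm E] (μ : Measure K) (p : ℝ)
    (w : K → ℝ) (f : K → E) : Prop :=
  MemLp f (ENNReal.ofReal p) (weighted μ w)

/-- The norm `‖M‖` of the maximal operator from `L^p(w)` to `L^p(w)`: the least `C ∈ [0, ∞]` with
`‖Mf‖ ≤ C ‖f‖` for all `f ∈ L^p(w)`. -/
noncomputable def maximalNorm (μ : Measure K) (p : ℝ) (w : K → ℝ) : ℝ≥0∞ :=
  sInf {C : ℝ≥0∞ | ∀ f : K → ℂ, MemWeighted μ p w f →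
    weightedNorm μ p w (maximalFn μ f) ≤ C * weightedNorm μ p w f}

/-- The power weight `|x|^((p-1)(1-θ))`. -/
noncomputable def powerWeight [IsNonarchimedeanLocalField K] (p θ : ℝ) (x : K) : ℝ :=
  absV x ^ ((p - 1) * (1 - θ))

/-- The function `|x|^(θ-1) · 1_𝔇`. -/
noncomputable def extremalFn [IsNonarchimedeanLocalField K] (θ : ℝ) : K → ℂ :=
  Set.indicator (𝒪[K] : Set K) fun x => ((absV x ^ (θ - 1) : ℝ) : ℂ)

end

end LocalFieldWeights

namespace LocalFieldWeights

/-! ### The maximal function of a countable laminar family -/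

section Laminar

variable {X : Type*} [MeasurableSpace X]

/-- The maximal function of `g` with respect to the measure `ν` and the family of sets `𝓑`. -/
noncomputable def familyMaximalFn (𝓑 : Set (Set X)) (ν : Measure X) (g : X → ℝ≥0∞) (x : X) :
    ℝ≥0∞ :=
  ⨆ (B : Set X) (_ : B ∈ 𝓑) (_ : x ∈ B), (ν B)⁻¹ * ∫⁻ y in B, g y ∂ν

/-- Any two members of the family are nested or disjoint. -/
def IsLaminar (𝓑 : Set (Set X)) : Prop :=
  ∀ A ∈ 𝓑, ∀ B ∈ 𝓑, A ⊆ B ∨ B ⊆ A ∨ Disjoint A B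

variable {𝓑 : Set (Set X)} {ν : Measure X} {g : X → ℝ≥0∞} {t : ℝ≥0∞}

theorem le_familyMaximalFn {B : Set X} (hB : B ∈ 𝓑) {x : X} (hx : x ∈ B) :
    (ν B)⁻¹ * ∫⁻ y in B, g y ∂ν ≤ familyMaximalFn 𝓑 ν g x :=
  le_iSup_of_le B <| le_iSup_of_le hB <| le_iSup_of_le hx le_rfl

theorem measurable_familyMaximalFn (hc : 𝓑.Countable) (hm : ∀ B ∈ 𝓑, MeasurableSet B) :
    Measurable (familyMaximalFn 𝓑 ν g) := by
  unfold familyMaximalFn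
  refine Measurable.biSup 𝓑 hc fun B hB => ?_
  have : (fun x => ⨆ (_ : x ∈ B), (ν B)⁻¹ * ∫⁻ y in B, g y ∂ν) =
      B.indicator fun _ => (ν B)⁻¹ * ∫⁻ y in B, g y ∂ν := by
    ext x
    by_cases hx : x ∈ B <;> simp [hx]
  rw [this]
  exact measurable_const.indicator (hm B hB)

theorem mul_measure_sUnion_finset_le (s : Finset (Set X)) (hl : IsLaminar (s : Set (Set X)))
    (hm : ∀ B ∈ s, MeasurableSet B) (ht : ∀ B ∈ s, t * ν B ≤ ∫⁻ y in B, g y ∂ν) :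
    t * ν (⋃ B ∈ s, B) ≤ ∫⁻ y, g y ∂ν := by
  classical
  let m := s.filter fun A => Maximal (· ∈ s) A
  have hms : ∀ A ∈ m, A ∈ s := fun A hA => (Finset.mem_filter.1 hA).1
  have hU : ⋃ B ∈ s, B = ⋃ B ∈ m, B := by
    apply subset_antisymm
    · intro x hx
      simp only [Set.mem_iUnion] at hx ⊢
      obtain ⟨B, hB, hxB⟩ := hx
      obtain ⟨A, hBA, hA⟩ := s.exists_le_maximal hB
      exact ⟨A, Finset.mem_filter.2 ⟨hA.prop, hA⟩, hBA hxB⟩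
    · exact Set.biUnion_subset_biUnion_left hms
  have hd : Set.PairwiseDisjoint (m : Set (Set X)) id := by
    intro A hA B hB hAB
    have hA' := (Finset.mem_filter.1 hA).2
    have hB' := (Finset.mem_filter.1 hB).2
    rcases hl A hA'.prop B hB'.prop with h | h | h
    · exact absurd (hA'.eq_of_subset hB'.prop h) hAB
    · exact absurd (hB'.eq_of_subset hA'.prop h).symm hAB
    · exact h
  rw [hU]
  calc t * ν (⋃ B ∈ m, B) = ∑ B ∈ m, t * ν B := by
        rw [← Finset.mul_sum]
        exact congrArg _ (measure_biUnion_finset hd fun B hB => hm B (hms B hB))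
    _ ≤ ∑ B ∈ m, ∫⁻ y in B, g y ∂ν := Finset.sum_le_sum fun B hB => ht B (hms B hB)
    _ = ∫⁻ y in ⋃ B ∈ m, B, g y ∂ν :=
        (lintegral_biUnion_finset hd (fun B hB => hm B (hms B hB)) g).symm
    _ ≤ ∫⁻ y, g y ∂ν := setLIntegral_le_lintegral _ _

theorem mul_measure_sUnion_le (hc : 𝓑.Countable) (hl : IsLaminar 𝓑)
    (hm : ∀ B ∈ 𝓑, MeasurableSet B) (ht : ∀ B ∈ 𝓑, t * ν B ≤ ∫⁻ y in B, g y ∂ν) :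
    t * ν (⋃₀ 𝓑) ≤ ∫⁻ y, g y ∂ν := by
  classical
  rcases 𝓑.eq_empty_or_nonempty with rfl | hne
  · simp
  obtain ⟨u, rfl⟩ := hc.exists_eq_range hne
  have hU : ⋃₀ Set.range u = ⋃ n, ⋃ B ∈ (Finset.range n).image u, B := by
    ext x
    simp only [Set.sUnion_range, Set.mem_iUnion, Finset.mem_image, Finset.mem_range]
    constructor
    · rintro ⟨n, hn⟩
      exact ⟨n + 1, u n, ⟨n, n.lt_succ_self, rfl⟩, hn⟩
    · rintro ⟨n, B, ⟨k, -, rfl⟩, hx⟩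
      exact ⟨k, hx⟩
  have hmono : Monotone fun n => ⋃ B ∈ (Finset.range n).image u, B := fun a b hab =>
    Set.biUnion_subset_biUnion_left
      (Finset.image_subset_image (Finset.range_mono hab))
  have hsub : ∀ n, ∀ B ∈ (Finset.range n).image u, B ∈ Set.range u := by
    intro n B hB
    obtain ⟨k, -, rfl⟩ := Finset.mem_image.1 hB
    exact ⟨k, rfl⟩
  rw [hU, hmono.measure_iUnion, ENNReal.mul_iSup]
  refine iSup_le fun n => mul_measure_sUnion_finset_le _ ?_ ?_ ?_
  · exact fun A hA B hB => hl A (hsub n A hA) B (hsub n B hB)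
  · exact fun B hB => hm B (hsub n B hB)
  · exact fun B hB => ht B (hsub n B hB)

theorem mul_measure_lt_familyMaximalFn_le (hc : 𝓑.Countable) (hl : IsLaminar 𝓑)
    (hm : ∀ B ∈ 𝓑, MeasurableSet B) :
    t * ν {x | t < familyMaximalFn 𝓑 ν g x} ≤ ∫⁻ y, g y ∂ν := by
  let 𝓖 := {B ∈ 𝓑 | t < (ν B)⁻¹ * ∫⁻ y in B, g y ∂ν}
  have hs : 𝓖 ⊆ 𝓑 := Set.sep_subset _ _
  have hU : {x | t < familyMaximalFn 𝓑 ν g x} ⊆ ⋃₀ 𝓖 := by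
    intro x hx
    simp only [Set.mem_ofPred_eq, familyMaximalFn, lt_iSup_iff] at hx
    obtain ⟨B, hB, hxB, h⟩ := hx
    exact ⟨B, ⟨hB, h⟩, hxB⟩
  refine le_trans (by gcongr) (mul_measure_sUnion_le (hc.mono hs)
    (fun A hA B hB => hl A (hs hA) B (hs hB)) (fun B hB => hm B (hs hB)) ?_)
  rintro B ⟨-, hB⟩
  rcases eq_or_ne (ν B) 0 with h0 | h0
  · simp [h0]
  rcases eq_or_ne (ν B) ∞ with h1 | h1
  · simp [h1] at hB
  calc t * ν B ≤ ((ν B)⁻¹ * ∫⁻ y in B, g y ∂ν) * ν B := by gcongr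
    _ = ∫⁻ y in B, g y ∂ν := by
      rw [mul_comm, ← mul_assoc, ENNReal.mul_inv_cancel h0 h1, one_mul]

theorem familyMaximalFn_le_add (x : X) :
    familyMaximalFn 𝓑 ν g x ≤ t + familyMaximalFn 𝓑 ν ({y | t < g y}.indicator g) x := by
  refine iSup_le fun B => iSup_le fun hB => iSup_le fun hx => ?_
  have hI : ∫⁻ y in B, g y ∂ν ≤ t * ν B + ∫⁻ y in B, {y | t < g y}.indicator g y ∂ν := by
    rw [← setLIntegral_const, ← lintegral_add_left measurable_const]
    refine lintegral_mono fun y => ?_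
    by_cases hy : t < g y
    · simp [hy]
    · simpa [hy] using not_lt.1 hy
  calc (ν B)⁻¹ * ∫⁻ y in B, g y ∂ν
      ≤ (ν B)⁻¹ * (t * ν B + ∫⁻ y in B, {y | t < g y}.indicator g y ∂ν) := by gcongr
    _ = t * ((ν B)⁻¹ * ν B) + (ν B)⁻¹ * ∫⁻ y in B, {y | t < g y}.indicator g y ∂ν := by ring
    _ ≤ t + familyMaximalFn 𝓑 ν ({y | t < g y}.indicator g) x :=
      add_le_add (mul_le_of_le_one_right' (ENNReal.inv_mul_le_one _)) (le_familyMaximalFn hB hx)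

theorem mul_measure_two_mul_lt_familyMaximalFn_le (hc : 𝓑.Countable) (hl : IsLaminar 𝓑)
    (hm : ∀ B ∈ 𝓑, MeasurableSet B) :
    t * ν {x | t + t < familyMaximalFn 𝓑 ν g x} ≤ ∫⁻ y, {y | t < g y}.indicator g y ∂ν := by
  refine le_trans ?_ (mul_measure_lt_familyMaximalFn_le (t := t) hc hl hm)
  refine mul_le_mul_right (measure_mono fun x hx => ?_) _
  exact lt_of_add_lt_add_left (hx.trans_le (familyMaximalFn_le_add x))

theorem setLIntegral_Ioi_indicator_rpow_le {r : ℝ} (hr : 1 < r) (a : ℝ≥0∞) :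
    ∫⁻ t in Set.Ioi (0 : ℝ), {t | ENNReal.ofReal (t / 2) < a}.indicator
        (fun t => ENNReal.ofReal (2 * t ^ (r - 2))) t ≤
      ENNReal.ofReal (2 / (r - 1)) * (2 * a) ^ (r - 1) := by
  have hr1 : 0 < r - 1 := by linarith
  rcases eq_or_ne a ∞ with rfl | ha
  · rw [ENNReal.mul_top (by simp), ENNReal.top_rpow_of_pos hr1, ENNReal.mul_top]
    · exact le_top
    · simpa using div_pos two_pos hr1
  lift a to ℝ≥0 using ha
  have h2a : (0 : ℝ) ≤ 2 * a := by positivity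
  have hint : IntervalIntegrable (fun t : ℝ => 2 * t ^ (r - 2)) volume 0 (2 * a) :=
    (intervalIntegral.intervalIntegrable_rpow' (by linarith)).const_mul 2
  calc ∫⁻ t in Set.Ioi (0 : ℝ), {t | ENNReal.ofReal (t / 2) < a}.indicator
        (fun t => ENNReal.ofReal (2 * t ^ (r - 2))) t
      ≤ ∫⁻ t in Set.Ioi (0 : ℝ), (Set.Ioc 0 (2 * a : ℝ)).indicator
        (fun t => ENNReal.ofReal (2 * t ^ (r - 2))) t := by
        refine setLIntegral_mono' measurableSet_Ioi fun t ht => ?_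
        by_cases h : ENNReal.ofReal (t / 2) < a
        · have h' : t / 2 < a := by
            rwa [← ENNReal.ofReal_coe_nnreal, ENNReal.ofReal_lt_ofReal_iff_of_nonneg] at h
            have : (0 : ℝ) < t := ht
            positivity
          rw [Set.indicator_of_mem (show t ∈ Set.Ioc 0 (2 * a : ℝ) from ⟨ht, by linarith⟩)]
          exact Set.indicator_le_self _ _ _
        · rw [Set.indicator_of_notMem (by simpa using h)]
          exact zero_le
    _ ≤ ∫⁻ t in Set.Ioc 0 (2 * a : ℝ), ENNReal.ofReal (2 * t ^ (r - 2)) := by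
        refine (setLIntegral_le_lintegral _ _).trans ?_
        rw [lintegral_indicator measurableSet_Ioc]
    _ = ENNReal.ofReal (∫ t in (0 : ℝ)..(2 * a), 2 * t ^ (r - 2)) := by
        rw [intervalIntegral.integral_of_le h2a, ofReal_integral_eq_lintegral_ofReal]
        · exact (intervalIntegrable_iff_integrableOn_Ioc_of_le h2a).1 hint
        · filter_upwards [ae_restrict_mem measurableSet_Ioc] with t ht
          have := ht.1
          positivity
    _ = ENNReal.ofReal (2 / (r - 1) * (2 * a) ^ (r - 1)) := by
        rw [intervalIntegral.integral_const_mul, integral_rpow (Or.inl (by linarith)),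
          show r - 2 + 1 = r - 1 by ring, Real.zero_rpow hr1.ne']
        congr 1
        ring
    _ = ENNReal.ofReal (2 / (r - 1)) * (2 * (a : ℝ≥0∞)) ^ (r - 1) := by
        rw [ENNReal.ofReal_mul (by positivity), ← ENNReal.ofReal_rpow_of_nonneg h2a hr1.le,
          ENNReal.ofReal_mul two_pos.le]
        simp

/-- The constant in the maximal inequality `∫ (Mg)^r ≤ C_r ∫ g^r`. -/
noncomputable def maximalConst (r : ℝ) : ℝ≥0 :=
  Real.toNNReal (r * (2 / (r - 1)) * 2 ^ (r - 1))

theorem maximalConst_pos {r : ℝ} (hr : 1 < r) : 0 < maximalConst r := by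
  have : 0 < r - 1 := by linarith
  have : 0 < r := by linarith
  rw [maximalConst, Real.toNNReal_pos]
  positivity

theorem lintegral_min_familyMaximalFn_rpow_le [SFinite ν] (hc : 𝓑.Countable) (hl : IsLaminar 𝓑)
    (hm : ∀ B ∈ 𝓑, MeasurableSet B) (hg : Measurable g) {r : ℝ} (hr : 1 < r) (n : ℕ) :
    ∫⁻ x, (min (familyMaximalFn 𝓑 ν g x) n) ^ r ∂ν ≤ maximalConst r * ∫⁻ x, g x ^ r ∂ν := by
  have hr0 : 0 < r := by linarith
  have hr1 : 0 < r - 1 := by linarith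
  set M := familyMaximalFn 𝓑 ν g with hM
  have hMm : Measurable M := measurable_familyMaximalFn hc hm
  have hfin : ∀ x, min (M x) n ≠ ∞ := fun x =>
    ((min_le_right _ _).trans_lt (ENNReal.natCast_lt_top n)).ne
  have hmh : Measurable fun x => (min (M x) n).toReal :=
    (hMm.min measurable_const).ennreal_toReal
  have hkey : ∀ t ∈ Set.Ioi (0 : ℝ),
      ν {x | t < (min (M x) n).toReal} * ENNReal.ofReal (t ^ (r - 1)) ≤
        ∫⁻ x, g x * {t | ENNReal.ofReal (t / 2) < g x}.indicator
          (fun t => ENNReal.ofReal (2 * t ^ (r - 2))) t ∂ν := by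
    intro t ht
    have ht0 : (0 : ℝ) < t := ht
    set s := ENNReal.ofReal (t / 2) with hs
    have hss : s + s = ENNReal.ofReal t := by
      rw [hs, ← ENNReal.ofReal_add (by positivity) (by positivity)]
      congr 1
      ring
    have hsub : ν {x | t < (min (M x) n).toReal} ≤ ν {x | s + s < M x} := by
      refine measure_mono fun x hx => ?_
      have hx' : ENNReal.ofReal t < min (M x) n :=
        (ENNReal.ofReal_lt_iff_lt_toReal ht0.le (hfin x)).2 hx
      change s + s < M x
      rw [hss]
      exact hx'.trans_le (min_le_left _ _)
    have hts : ENNReal.ofReal (t ^ (r - 1)) = ENNReal.ofReal (2 * t ^ (r - 2)) * s := by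
      rw [hs, ← ENNReal.ofReal_mul (by positivity)]
      congr 1
      rw [show r - 1 = (r - 2) + 1 by ring, Real.rpow_add_one ht0.ne']
      ring
    calc ν {x | t < (min (M x) n).toReal} * ENNReal.ofReal (t ^ (r - 1))
        ≤ ν {x | s + s < M x} * (ENNReal.ofReal (2 * t ^ (r - 2)) * s) := by
          rw [hts]
          gcongr
      _ = ENNReal.ofReal (2 * t ^ (r - 2)) * (s * ν {x | s + s < M x}) := by ring
      _ ≤ ENNReal.ofReal (2 * t ^ (r - 2)) * ∫⁻ y, {y | s < g y}.indicator g y ∂ν := by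
          gcongr
          exact mul_measure_two_mul_lt_familyMaximalFn_le hc hl hm
      _ = ∫⁻ x, g x * {t | ENNReal.ofReal (t / 2) < g x}.indicator
          (fun t => ENNReal.ofReal (2 * t ^ (r - 2))) t ∂ν := by
          rw [← lintegral_const_mul _ (hg.indicator (measurableSet_lt measurable_const hg))]
          refine lintegral_congr fun x => ?_
          by_cases hx : s < g x
          · have hx' : ENNReal.ofReal (t / 2) < g x := hx
            simp [hx, hx', mul_comm]
          · have hx' : ¬ ENNReal.ofReal (t / 2) < g x := hx
            simp [hx, hx']
  have hjm : Measurable (Function.uncurry fun (t : ℝ) (x : X) =>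
      g x * {t | ENNReal.ofReal (t / 2) < g x}.indicator
          (fun t => ENNReal.ofReal (2 * t ^ (r - 2))) t) := by
    have hset : MeasurableSet {q : ℝ × X | ENNReal.ofReal (q.1 / 2) < g q.2} :=
      measurableSet_lt (by fun_prop) (by fun_prop)
    have hind : Measurable ({q : ℝ × X | ENNReal.ofReal (q.1 / 2) < g q.2}.indicator
        fun q => ENNReal.ofReal (2 * q.1 ^ (r - 2))) :=
      Measurable.indicator (by fun_prop) hset
    exact (hg.comp measurable_snd).mul hind
  calc ∫⁻ x, (min (M x) n) ^ r ∂ν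
      = ∫⁻ x, ENNReal.ofReal ((min (M x) n).toReal ^ r) ∂ν := by
        refine lintegral_congr fun x => ?_
        rw [← ENNReal.ofReal_rpow_of_nonneg ENNReal.toReal_nonneg hr0.le,
          ENNReal.ofReal_toReal (hfin x)]
    _ = ENNReal.ofReal r * ∫⁻ t in Set.Ioi 0,
          ν {x | t < (min (M x) n).toReal} * ENNReal.ofReal (t ^ (r - 1)) :=
        lintegral_rpow_eq_lintegral_meas_lt_mul ν
          (Eventually.of_forall fun _ => ENNReal.toReal_nonneg) hmh.aemeasurable hr0
    _ ≤ ENNReal.ofReal r * ∫⁻ t in Set.Ioi (0 : ℝ),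
          ∫⁻ x, g x * {t | ENNReal.ofReal (t / 2) < g x}.indicator
            (fun t => ENNReal.ofReal (2 * t ^ (r - 2))) t ∂ν := by
        gcongr 1
        exact setLIntegral_mono' measurableSet_Ioi hkey
    _ = ENNReal.ofReal r * ∫⁻ x, (∫⁻ t in Set.Ioi (0 : ℝ),
          g x * {t | ENNReal.ofReal (t / 2) < g x}.indicator
            (fun t => ENNReal.ofReal (2 * t ^ (r - 2))) t) ∂ν := by
        rw [lintegral_lintegral_swap hjm.aemeasurable]
    _ ≤ ENNReal.ofReal r * ∫⁻ x,
          g x * (ENNReal.ofReal (2 / (r - 1)) * (2 * g x) ^ (r - 1)) ∂ν := by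
        gcongr with x
        rw [lintegral_const_mul _ (Measurable.indicator (by fun_prop)
          (measurableSet_lt (by fun_prop) measurable_const))]
        gcongr
        exact setLIntegral_Ioi_indicator_rpow_le hr (g x)
    _ = maximalConst r * ∫⁻ x, g x ^ r ∂ν := by
        have : ∀ x, g x * (ENNReal.ofReal (2 / (r - 1)) * (2 * g x) ^ (r - 1)) =
            ENNReal.ofReal (2 / (r - 1)) * ENNReal.ofReal (2 ^ (r - 1)) * g x ^ r := by
          intro x
          rw [ENNReal.mul_rpow_of_nonneg _ _ hr1.le, ← ENNReal.ofReal_rpow_of_pos two_pos,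
            ENNReal.ofReal_ofNat]
          have : g x ^ r = g x * g x ^ (r - 1) := by
            conv_lhs => rw [show r = 1 + (r - 1) by ring,
              ENNReal.rpow_add_of_nonneg _ _ zero_le_one hr1.le, ENNReal.rpow_one]
          rw [this]
          ring
        simp_rw [this]
        rw [lintegral_const_mul _ (hg.pow_const r), ← mul_assoc]
        congr 1
        rw [← ENNReal.ofReal_mul (by positivity), ← ENNReal.ofReal_mul hr0.le, maximalConst,
          mul_assoc]
        rfl

theorem lintegral_familyMaximalFn_rpow_le [SFinite ν] (hc : 𝓑.Countable) (hl : IsLaminar 𝓑)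
    (hm : ∀ B ∈ 𝓑, MeasurableSet B) (hg : Measurable g) {r : ℝ} (hr : 1 < r) :
    ∫⁻ x, familyMaximalFn 𝓑 ν g x ^ r ∂ν ≤ maximalConst r * ∫⁻ x, g x ^ r ∂ν := by
  have hr0 : 0 < r := by linarith
  have hMm : Measurable (familyMaximalFn 𝓑 ν g) := measurable_familyMaximalFn hc hm
  have hsup : ∀ a : ℝ≥0∞, a ^ r = ⨆ n : ℕ, (min a n) ^ r := by
    intro a
    have h : a = ⨆ n : ℕ, min a n := by
      rw [← inf_iSup_eq, ENNReal.iSup_natCast]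
      simp
    have := (ENNReal.orderIsoRpow r hr0).map_iSup fun n : ℕ => min a (n : ℝ≥0∞)
    simp only [ENNReal.orderIsoRpow_apply] at this
    rw [← this, ← h]
  rw [lintegral_congr fun x => hsup (familyMaximalFn 𝓑 ν g x),
    lintegral_iSup fun n => (hMm.min measurable_const).pow_const r]
  · exact iSup_le fun n => lintegral_min_familyMaximalFn_rpow_le hc hl hm hg hr n
  · intro a b hab x
    dsimp only
    gcongr

end Laminar

/-! ### Balls and the absolute value of a local field -/

section Balls

variable {K : Type*} [Field K] [ValuativeRel K]

/-- The ball `h + a𝔇`. -/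
def ball (h a : K) : Set K :=
  {y | ValuativeRel.valuation K (y - h) ≤ ValuativeRel.valuation K a}

theorem mem_ball {h a y : K} :
    y ∈ ball h a ↔ ValuativeRel.valuation K (y - h) ≤ ValuativeRel.valuation K a := Iff.rfl

theorem mem_ball_zero {a y : K} :
    y ∈ ball 0 a ↔ ValuativeRel.valuation K y ≤ ValuativeRel.valuation K a := by
  rw [mem_ball, sub_zero]

theorem mem_ball_self (h a : K) : h ∈ ball h a := by simp [mem_ball]

theorem isBall_ball (h : K) {a : K} (ha : a ≠ 0) : IsBall (ball h a) := ⟨h, a, ha, rfl⟩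

theorem IsBall.exists_eq_ball {B : Set K} (hB : IsBall B) : ∃ h a : K, a ≠ 0 ∧ B = ball h a := hB

theorem IsBall.nonempty {B : Set K} (hB : IsBall B) : B.Nonempty := by
  obtain ⟨h, a, ha, rfl⟩ := hB.exists_eq_ball
  exact ⟨h, mem_ball_self h a⟩

theorem valuation_ne_zero {a : K} (ha : a ≠ 0) : ValuativeRel.valuation K a ≠ 0 :=
  (Valuation.ne_zero_iff _).2 ha

theorem integer_eq_ball : (𝒪[K] : Set K) = ball 0 1 := by
  ext x
  simp [mem_ball, Valuation.mem_integer_iff]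

theorem ball_subset_ball {h k a b : K}
    (hab : ValuativeRel.valuation K a ≤ ValuativeRel.valuation K b)
    (hk : h ∈ ball k b) : ball h a ⊆ ball k b := by
  intro y hy
  have : y - k = (y - h) + (h - k) := by ring
  rw [mem_ball, this]
  exact (Valuation.map_add _ _ _).trans (max_le (hy.trans hab) hk)

theorem mem_ball_comm {h k a : K} : h ∈ ball k a ↔ k ∈ ball h a := by
  rw [mem_ball, mem_ball, Valuation.map_sub_swap]

theorem ball_eq_ball {h k a : K} (hk : h ∈ ball k a) : ball h a = ball k a :=
  (ball_subset_ball le_rfl hk).antisymm (ball_subset_ball le_rfl (mem_ball_comm.1 hk))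

theorem isLaminar_isBall : IsLaminar {B : Set K | IsBall B} := by
  suffices H : ∀ h a k b : K, ValuativeRel.valuation K a ≤ ValuativeRel.valuation K b →
      ball h a ⊆ ball k b ∨ Disjoint (ball h a) (ball k b) by
    rintro _ ⟨h, a, -, rfl⟩ _ ⟨k, b, -, rfl⟩
    rcases le_total (ValuativeRel.valuation K a) (ValuativeRel.valuation K b) with hab | hab
    · rcases H h a k b hab with h1 | h1
      · exact Or.inl h1
      · exact Or.inr (Or.inr h1)
    · rcases H k b h a hab with h1 | h1
      · exact Or.inr (Or.inl h1)
      · exact Or.inr (Or.inr h1.symm)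
  intro h a k b hab
  by_cases hd : Disjoint (ball h a) (ball k b)
  · exact Or.inr hd
  · obtain ⟨x, hx, hx'⟩ := Set.not_disjoint_iff.1 hd
    left
    rw [← ball_eq_ball hx]
    exact ball_subset_ball hab hx'

theorem preimage_mul_ball_zero {a b : K} (ha : a ≠ 0) :
    (fun x => a * x) ⁻¹' ball 0 (a * b) = ball 0 b := by
  ext x
  simp only [Set.mem_preimage, mem_ball_zero, map_mul]
  exact mul_le_mul_iff_right₀ (zero_lt_iff.2 (valuation_ne_zero ha))

theorem valuation_eq_of_mem_ball {h a y : K} (h0 : (0 : K) ∉ ball h a) (hy : y ∈ ball h a) :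
    ValuativeRel.valuation K y = ValuativeRel.valuation K h := by
  rw [mem_ball, zero_sub, Valuation.map_neg, not_le] at h0
  exact Valuation.map_eq_of_sub_lt _ (lt_of_le_of_lt hy h0)

variable [TopologicalSpace K] [IsNonarchimedeanLocalField K]

theorem isOpen_ball (h : K) {a : K} (ha : a ≠ 0) : IsOpen (ball h a) := by
  rw [isOpen_iff_mem_nhds]
  intro x hx
  rw [(IsValuativeTopology.hasBasis_nhds' x).mem_iff]
  refine ⟨ValuativeRel.valuation K a, valuation_ne_zero ha, fun y hy => ?_⟩
  rw [← ball_eq_ball hx]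
  exact (show ValuativeRel.valuation K (y - x) < ValuativeRel.valuation K a from hy).le

theorem isCompact_ball (h a : K) : IsCompact (ball h a) := by
  have := (IsNonarchimedeanLocalField.isCompact_closedBall K
    (ValuativeRel.valuation K a)).image (continuous_add_const h)
  convert this using 1
  ext y
  simp only [mem_ball, Set.mem_image, Set.mem_ofPred_eq]
  exact ⟨fun hy => ⟨y - h, hy, by ring⟩, by rintro ⟨x, hx, rfl⟩; simpa using hx⟩

theorem IsBall.isOpen {B : Set K} (hB : IsBall B) : IsOpen B := by
  obtain ⟨h, a, ha, rfl⟩ := hB.exists_eq_ball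
  exact isOpen_ball h ha

theorem IsBall.isCompact {B : Set K} (hB : IsBall B) : IsCompact B := by
  obtain ⟨h, a, ha, rfl⟩ := hB.exists_eq_ball
  exact isCompact_ball h a

theorem exists_ball_subset {U : Set K} (hU : IsOpen U) {x : K} (hx : x ∈ U) :
    ∃ a : K, a ≠ 0 ∧ ball x a ⊆ U := by
  obtain ⟨γ, hγ, hγU⟩ := (IsValuativeTopology.hasBasis_nhds' x).mem_iff.1 (hU.mem_nhds hx)
  obtain ⟨a, rfl⟩ := ValuativeRel.valuation_surjective γ
  obtain ⟨b, hb, hb1⟩ := Valuation.IsNontrivial.exists_lt_one (v := ValuativeRel.valuation K)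
  have hb' : b ≠ 0 := hb
  have ha : a ≠ 0 := (Valuation.ne_zero_iff _).1 hγ
  refine ⟨a * b, mul_ne_zero ha hb', fun y hy => hγU ?_⟩
  refine lt_of_le_of_lt (mem_ball.1 hy) ?_
  rw [map_mul]
  exact mul_lt_of_lt_one_right (zero_lt_iff.2 hγ) hb1

variable (K) in
theorem countable_valueGroup : Countable (ValuativeRel.ValueGroupWithZero K) := by
  have : Countable (WithZero (Multiplicative ℤ)) := inferInstanceAs (Countable (Option ℤ))
  exact (IsNonarchimedeanLocalField.valueGroupWithZeroIsoInt K).toEquiv.injective.countable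

variable (K) in
theorem sigmaCompactSpace : SigmaCompactSpace K := by
  have := countable_valueGroup K
  refine SigmaCompactSpace.of_countable (Set.range fun γ : ValuativeRel.ValueGroupWithZero K =>
    {x | ValuativeRel.valuation K x ≤ γ}) (Set.countable_range _) ?_ ?_
  · rintro _ ⟨γ, rfl⟩
    exact IsNonarchimedeanLocalField.isCompact_closedBall K γ
  · exact Set.eq_univ_of_forall fun x => 
      ⟨_, ⟨ValuativeRel.valuation K x, rfl⟩, le_refl (ValuativeRel.valuation K x)⟩

variable (K) in
theorem countable_setOf_isBall : {B : Set K | IsBall B}.Countable := by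
  have := countable_valueGroup K
  have := sigmaCompactSpace K
  have hsub : {B : Set K | IsBall B} ⊆ ⋃ γ : ValuativeRel.ValueGroupWithZero K,
      {B | ∃ h a, a ≠ 0 ∧ ValuativeRel.valuation K a = γ ∧ B = ball h a} := by
    rintro B ⟨h, a, ha, rfl⟩
    exact Set.mem_iUnion.2 ⟨_, h, a, ha, rfl, rfl⟩
  refine (Set.countable_iUnion fun γ => ?_).mono hsub
  obtain ⟨a, rfl⟩ := ValuativeRel.valuation_surjective γ
  rcases eq_or_ne a 0 with rfl | ha
  · refine Set.countable_empty.mono ?_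
    rintro B ⟨h, b, hb, hb0, -⟩
    exact valuation_ne_zero hb (hb0.trans (map_zero _))
  obtain ⟨s, hs, hsU⟩ := LindelofSpace.elim_nhds_subcover (fun h : K => ball h a)
    fun h => (isOpen_ball h ha).mem_nhds (mem_ball_self h a)
  refine (hs.image fun h => ball h a).mono ?_
  rintro B ⟨h, b, hb, hba, rfl⟩
  have hball : ball h b = ball h a := by
    simp only [ball, hba]
  have : h ∈ ⋃ k ∈ s, ball k a := hsU ▸ Set.mem_univ h
  simp only [Set.mem_iUnion] at this
  obtain ⟨k, hk, hhk⟩ := this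
  exact ⟨k, hk, by rw [hball, ball_eq_ball hhk]⟩

variable (K) in
theorem secondCountableTopology : SecondCountableTopology K :=
  (TopologicalSpace.isTopologicalBasis_of_isOpen_of_nhds (s := {B : Set K | IsBall B})
    (fun _ hB => IsBall.isOpen hB) fun x U hx hU => by
      obtain ⟨a, ha, haU⟩ := exists_ball_subset hU hx
      exact ⟨ball x a, isBall_ball x ha, mem_ball_self x a, haU⟩).secondCountableTopology
    (countable_setOf_isBall K)

variable [MeasurableSpace K] [BorelSpace K]

theorem IsBall.measurableSet {B : Set K} (hB : IsBall B) : MeasurableSet B :=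
  hB.isOpen.measurableSet

theorem measurable_comp_valuation {α : Type*} [MeasurableSpace α]
    (g : ValuativeRel.ValueGroupWithZero K → α) :
    Measurable fun x : K => g (ValuativeRel.valuation K x) := by
  have := countable_valueGroup K
  let _ : MeasurableSpace (ValuativeRel.ValueGroupWithZero K) := ⊤
  have hopen : ∀ γ : ValuativeRel.ValueGroupWithZero K, γ ≠ 0 →
      IsOpen {x : K | ValuativeRel.valuation K x = γ} := by
    intro γ hγ
    rw [isOpen_iff_mem_nhds]
    rintro x rfl
    rw [(IsValuativeTopology.hasBasis_nhds' x).mem_iff]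
    exact ⟨_, hγ, fun y hy => Valuation.map_eq_of_sub_lt _ hy⟩
  have hv : Measurable fun x : K => ValuativeRel.valuation K x := by
    refine measurable_to_countable' fun γ => ?_
    rcases eq_or_ne γ 0 with rfl | hγ
    · have : (fun x : K => ValuativeRel.valuation K x) ⁻¹' {0} =
          (⋃ (γ : ValuativeRel.ValueGroupWithZero K) (_ : γ ≠ 0),
            {x : K | ValuativeRel.valuation K x = γ})ᶜ := by
        ext x
        simp only [Set.mem_preimage, Set.mem_singleton_iff, Set.mem_compl_iff, Set.mem_iUnion,
          Set.mem_ofPred_eq, exists_prop, not_exists, not_and]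
        exact ⟨fun h γ hγ h' => hγ (h'.symm.trans h), fun h => by_contra fun h' => h _ h' rfl⟩
      rw [this]
      exact (isOpen_biUnion fun γ hγ => hopen γ hγ).measurableSet.compl
    · exact (hopen γ hγ).measurableSet
  exact (measurable_from_top (f := g)).comp hv

variable (μ : Measure K) [μ.IsAddHaarMeasure]

theorem regular_of_isAddHaarMeasure : μ.Regular := by
  have := sigmaCompactSpace K
  have := secondCountableTopology K
  infer_instance

omit [BorelSpace K] in
theorem sigmaFinite_of_isAddHaarMeasure : SigmaFinite μ := by
  have := sigmaCompactSpace K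
  infer_instance

variable {μ}

omit [BorelSpace K] in
theorem IsBall.measure_ne_zero {B : Set K} (hB : IsBall B) : μ B ≠ 0 :=
  (hB.isOpen.measure_pos μ hB.nonempty).ne'

omit [BorelSpace K] in
theorem IsBall.measure_ne_top {B : Set K} (hB : IsBall B) : μ B ≠ ∞ :=
  hB.isCompact.measure_lt_top.ne

end Balls

section AbsV

variable {K : Type*} [Field K] [ValuativeRel K] [TopologicalSpace K] [IsNonarchimedeanLocalField K]

theorem absV_zero : absV (0 : K) = 0 := by simp [absV]

theorem absV_of_ne_zero {x : K} (hx : x ≠ 0) :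
    absV x = distribHaarChar K (Units.mk0 x hx) := by simp [absV, hx]

theorem absV_pos {x : K} (hx : x ≠ 0) : 0 < absV x := by
  rw [absV_of_ne_zero hx]
  exact_mod_cast distribHaarChar_pos

theorem absV_nonneg (x : K) : 0 ≤ absV x := by
  rcases eq_or_ne x 0 with rfl | hx
  · rw [absV_zero]
  · exact (absV_pos hx).le

theorem absV_mul (x y : K) : absV (x * y) = absV x * absV y := by
  rcases eq_or_ne x 0 with rfl | hx
  · simp [absV_zero]
  rcases eq_or_ne y 0 with rfl | hy
  · simp [absV_zero]
  rw [absV_of_ne_zero hx, absV_of_ne_zero hy, absV_of_ne_zero (mul_ne_zero hx hy), ← NNReal.coe_mul,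
    ← map_mul]
  congr 2
  ext
  simp

theorem absV_one : absV (1 : K) = 1 := by
  rw [absV_of_ne_zero one_ne_zero, Units.mk0_one, map_one, NNReal.coe_one]

variable [MeasurableSpace K] [BorelSpace K] (μ : Measure K) [μ.IsAddHaarMeasure]

open scoped Pointwise in
theorem measure_preimage_mul {a : K} (ha : a ≠ 0) (s : Set K) :
    ENNReal.ofReal (absV a) * μ ((fun x => a * x) ⁻¹' s) = μ s := by
  have := regular_of_isAddHaarMeasure μ
  have hs : (Units.mk0 a ha) • ((fun x => a * x) ⁻¹' s) = s := by
    ext x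
    rw [Set.mem_smul_set_iff_inv_smul_mem]
    simp [Units.smul_def, ha]
  rw [absV_of_ne_zero ha, ENNReal.ofReal_coe_nnreal, distribHaarChar_mul, hs]

theorem lintegral_comp_mul {a : K} (ha : a ≠ 0) (f : K → ℝ≥0∞) :
    ENNReal.ofReal (absV a) * ∫⁻ x, f (a * x) ∂μ = ∫⁻ x, f x ∂μ := by
  have hmap : ENNReal.ofReal (absV a) • μ.map (fun x => a * x) = μ := by
    ext s hs
    rw [Measure.smul_apply, Measure.map_apply (by fun_prop) hs, smul_eq_mul,
      measure_preimage_mul μ ha]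
  have he : MeasurableEmbedding fun x : K => a * x :=
    (Homeomorph.mulLeft₀ a ha).measurableEmbedding
  conv_rhs => rw [← hmap, lintegral_smul_measure, he.lintegral_map]
  rfl

theorem measure_ball_zero {a : K} (ha : a ≠ 0) :
    μ (ball 0 a) = ENNReal.ofReal (absV a) * μ (ball 0 (1 : K)) := by
  rw [← measure_preimage_mul μ ha, ← preimage_mul_ball_zero (b := (1 : K)) ha, mul_one]

omit [MeasurableSpace K] [BorelSpace K] in
theorem absV_lt_absV {x y : K}
    (h : ValuativeRel.valuation K x < ValuativeRel.valuation K y) : absV x < absV y := by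
  have hy : y ≠ 0 := by
    rintro rfl
    simp at h
  rcases eq_or_ne x 0 with rfl | hx
  · rw [absV_zero]
    exact absV_pos hy
  borelize K
  let μ : Measure K := Measure.addHaar
  have hsub : ball 0 x ∪ ball y x ⊆ ball 0 y :=
    Set.union_subset (ball_subset_ball h.le (mem_ball_self 0 y))
      (ball_subset_ball h.le (mem_ball_zero.2 le_rfl))
  have hdisj : Disjoint (ball 0 x) (ball y x) := by
    rw [Set.disjoint_left]
    intro z hz hz'
    have h0 : (0 : K) ∉ ball y x := by
      rw [mem_ball, zero_sub, Valuation.map_neg]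
      exact not_le.2 h
    rw [mem_ball_zero, valuation_eq_of_mem_ball h0 hz'] at hz
    exact not_le.2 h hz
  have hle : μ (ball 0 x) + μ (ball y x) ≤ μ (ball 0 y) := by
    rw [← measure_union hdisj (isBall_ball y hx).measurableSet]
    exact measure_mono hsub
  have hlt : μ (ball 0 x) < μ (ball 0 y) :=
    (ENNReal.lt_add_right (isBall_ball 0 hx).measure_ne_top
      (isBall_ball y hx).measure_ne_zero).trans_le hle
  rw [measure_ball_zero μ hx, measure_ball_zero μ hy] at hlt
  exact (ENNReal.ofReal_lt_ofReal_iff (absV_pos hy)).1 (lt_of_mul_lt_mul_right' hlt)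

omit [MeasurableSpace K] [BorelSpace K] in
theorem absV_le_absV {x y : K}
    (h : ValuativeRel.valuation K x ≤ ValuativeRel.valuation K y) : absV x ≤ absV y := by
  rcases h.lt_or_eq with h' | h'
  · exact (absV_lt_absV h').le
  rcases eq_or_ne x 0 with rfl | hx
  · rw [absV_zero]
    exact absV_nonneg y
  have hy : y ≠ 0 := by
    rintro rfl
    exact valuation_ne_zero hx (h'.trans (map_zero _))
  borelize K
  let μ : Measure K := Measure.addHaar
  have hle : μ (ball 0 x) ≤ μ (ball 0 y) :=
    measure_mono (ball_subset_ball h (mem_ball_self 0 y))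
  have h1 : IsBall (ball 0 (1 : K)) := isBall_ball 0 one_ne_zero
  rw [measure_ball_zero μ hx, measure_ball_zero μ hy,
    ENNReal.mul_le_mul_iff_left h1.measure_ne_zero h1.measure_ne_top] at hle
  exact (ENNReal.ofReal_le_ofReal_iff (absV_nonneg y)).1 hle

omit [MeasurableSpace K] [BorelSpace K] in
theorem absV_congr {x y : K}
    (h : ValuativeRel.valuation K x = ValuativeRel.valuation K y) : absV x = absV y :=
  (absV_le_absV h.le).antisymm (absV_le_absV h.ge)

omit μ in
theorem measurable_absV : Measurable (absV : K → ℝ) := by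
  let g : ValuativeRel.ValueGroupWithZero K → ℝ := fun γ =>
    absV (Function.surjInv ValuativeRel.valuation_surjective γ : K)
  have : (absV : K → ℝ) = fun x => g (ValuativeRel.valuation K x) := by
    ext x
    exact absV_congr (Function.surjInv_eq ValuativeRel.valuation_surjective _).symm
  rw [this]
  exact measurable_comp_valuation g

theorem measure_singleton_zero : μ ({0} : Set K) = 0 := by
  obtain ⟨b, hb, hb1⟩ := Valuation.IsNontrivial.exists_lt_one (v := ValuativeRel.valuation K)
  have hb' : b ≠ 0 := hb
  have h1 : absV b < 1 := by
    rw [← absV_one (K := K)]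
    exact absV_lt_absV (by simpa using hb1)
  have hpre : (fun x => b * x) ⁻¹' ({0} : Set K) = {0} := by
    ext x
    simp [hb']
  have h := measure_preimage_mul μ hb' ({0} : Set K)
  rw [hpre] at h
  by_contra h0
  have hfin : μ ({0} : Set K) ≠ ∞ := isCompact_singleton.measure_lt_top.ne
  have : ENNReal.ofReal (absV b) = 1 := by
    rwa [← ENNReal.mul_left_inj h0 hfin, one_mul]
  rw [ENNReal.ofReal_eq_one] at this
  exact h1.ne this

theorem ae_ne_zero : ∀ᵐ x ∂μ, x ≠ (0 : K) := by
  rw [ae_iff]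
  simpa using measure_singleton_zero μ

end AbsV

/-! ### The maximal inequality for `A_p` weights -/

section Upper

variable {K : Type*} [Field K] [ValuativeRel K] [TopologicalSpace K] [IsNonarchimedeanLocalField K]
  [MeasurableSpace K] [BorelSpace K] (μ : Measure K) [μ.IsAddHaarMeasure]

theorem average_rpow_le {p : ℝ} (hp : 1 < p) {b w s I J A : ℝ≥0∞} (hb0 : b ≠ 0) (hb : b ≠ ∞)
    (hw0 : w ≠ 0) (hs0 : s ≠ 0) (hA : A ≠ ∞)
    (h : b⁻¹ * w * (b⁻¹ * s) ^ (p - 1) ≤ A) (hJ : (s⁻¹ * I) ^ (p - 1) * b ≤ J) :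
    (b⁻¹ * I) ^ (p - 1) ≤ A * (w⁻¹ * J) := by
  have hp1 : 0 < p - 1 := by linarith
  have hbi0 : b⁻¹ ≠ 0 := ENNReal.inv_ne_zero.2 hb
  have hbs0 : (b⁻¹ * s) ^ (p - 1) ≠ 0 := by
    rw [Ne, ENNReal.rpow_eq_zero_iff_of_pos hp1]
    exact mul_ne_zero hbi0 hs0
  have hprod : b⁻¹ * w * (b⁻¹ * s) ^ (p - 1) ≠ ∞ := (h.trans_lt hA.lt_top).ne
  have hw : w ≠ ∞ := by
    rintro rfl
    exact hprod (by rw [ENNReal.mul_top hbi0, ENNReal.top_mul hbs0])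
  have hs : s ≠ ∞ := by
    rintro rfl
    exact hprod (by
      rw [ENNReal.mul_top hbi0, ENNReal.top_rpow_of_pos hp1,
        ENNReal.mul_top (mul_ne_zero hbi0 hw0)])
  calc (b⁻¹ * I) ^ (p - 1)
      = (b⁻¹ * s) ^ (p - 1) * (s⁻¹ * I) ^ (p - 1) := by
        rw [← ENNReal.mul_rpow_of_nonneg _ _ hp1.le]
        congr 1
        rw [mul_assoc, ← mul_assoc s, ENNReal.mul_inv_cancel hs0 hs, one_mul]
    _ = (b⁻¹ * b) * (w * w⁻¹) * ((b⁻¹ * s) ^ (p - 1) * (s⁻¹ * I) ^ (p - 1)) := by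
        rw [ENNReal.inv_mul_cancel hb0 hb, ENNReal.mul_inv_cancel hw0 hw, one_mul, one_mul]
    _ = (b⁻¹ * w * (b⁻¹ * s) ^ (p - 1)) * (w⁻¹ * ((s⁻¹ * I) ^ (p - 1) * b)) := by ring
    _ ≤ A * (w⁻¹ * J) := by gcongr

variable {μ} {p : ℝ} {W F : K → ℝ≥0∞} {A : ℝ≥0∞}

theorem familyMaximalFn_rpow_le (hp : 1 < p) (hW : Measurable W) (hW0 : ∀ x, W x ≠ 0)
    (hWt : ∀ x, W x ≠ ∞) (hF : Measurable F) (hA : A ≠ ∞)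
    (hAp : ∀ B : Set K, IsBall B → ((μ B)⁻¹ * ∫⁻ x in B, W x ∂μ) *
      ((μ B)⁻¹ * ∫⁻ x in B, W x ^ (-(1 / (p - 1))) ∂μ) ^ (p - 1) ≤ A) (x : K) :
    familyMaximalFn {B : Set K | IsBall B} μ F x ^ (p - 1) ≤
      A * familyMaximalFn {B : Set K | IsBall B} (μ.withDensity W)
        (fun y => familyMaximalFn {B : Set K | IsBall B}
          (μ.withDensity fun z => W z ^ (-(1 / (p - 1))))
          (fun z => F z * (W z ^ (-(1 / (p - 1))))⁻¹) y ^ (p - 1) * (W y)⁻¹) x := by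
  have hp1 : 0 < p - 1 := by linarith
  set S : K → ℝ≥0∞ := fun z => W z ^ (-(1 / (p - 1))) with hS
  have hSm : Measurable S := hW.pow_const _
  have hS0 : ∀ z, S z ≠ 0 := fun z => (ENNReal.rpow_pos (hW0 z).bot_lt (hWt z)).ne'
  have hSt : ∀ z, S z ≠ ∞ := fun z => ENNReal.rpow_ne_top_of_ne_zero (hW0 z) (hWt z)
  set N : K → ℝ≥0∞ := familyMaximalFn {B : Set K | IsBall B} (μ.withDensity S)
    (fun z => F z * (S z)⁻¹) with hN
  have hNm : Measurable N :=
    measurable_familyMaximalFn (countable_setOf_isBall K) fun B hB => IsBall.measurableSet hB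
  rw [← ENNReal.le_rpow_inv_iff hp1]
  refine iSup_le fun B => iSup_le fun hB => iSup_le fun hx => ?_
  rw [ENNReal.le_rpow_inv_iff hp1]
  have hBm : MeasurableSet B := IsBall.measurableSet hB
  have hpos : ∀ V : K → ℝ≥0∞, Measurable V → (∀ z, V z ≠ 0) → ∫⁻ z in B, V z ∂μ ≠ 0 := by
    intro V hV hV0 h0
    rw [lintegral_eq_zero_iff hV] at h0
    have : ∀ᵐ z ∂μ.restrict B, False := h0.mono fun z hz => hV0 z hz
    rw [ae_iff] at this
    simp only [not_false_eq_true, Set.ofPred_true, Measure.restrict_apply_univ] at this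
    exact IsBall.measure_ne_zero hB this
  have hJ : ((∫⁻ z in B, S z ∂μ)⁻¹ * ∫⁻ z in B, F z ∂μ) ^ (p - 1) * μ B ≤
      ∫⁻ y in B, N y ^ (p - 1) * (W y)⁻¹ ∂(μ.withDensity W) := by
    rw [setLIntegral_withDensity_eq_setLIntegral_mul (g := fun y => N y ^ (p - 1) * (W y)⁻¹) _ hW
        ((hNm.pow_const _).mul hW.inv) hBm,
      ← setLIntegral_const]
    refine setLIntegral_mono' hBm fun y hy => ?_
    have h1 : (∫⁻ z in B, S z ∂μ)⁻¹ * ∫⁻ z in B, F z ∂μ ≤ N y := by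
      refine le_trans (le_of_eq ?_) (le_familyMaximalFn hB hy)
      rw [withDensity_apply _ hBm,
        setLIntegral_withDensity_eq_setLIntegral_mul (g := fun z => F z * (S z)⁻¹) _ hSm
          (hF.mul hSm.inv) hBm]
      congr 1
      refine lintegral_congr fun z => ?_
      simp only [Pi.mul_apply]
      rw [mul_comm (F z), ← mul_assoc, ENNReal.mul_inv_cancel (hS0 z) (hSt z), one_mul]
    have h2 : (W * fun y => N y ^ (p - 1) * (W y)⁻¹) y = N y ^ (p - 1) := by
      simp only [Pi.mul_apply]
      rw [mul_comm (N y ^ (p - 1)), ← mul_assoc, ENNReal.mul_inv_cancel (hW0 y) (hWt y), one_mul]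
    rw [h2]
    gcongr
  refine (average_rpow_le hp (IsBall.measure_ne_zero hB) (IsBall.measure_ne_top hB)
    (hpos W hW hW0) (hpos S hSm hS0) hA (hAp B hB) hJ).trans ?_
  gcongr
  rw [← withDensity_apply _ hBm]
  exact le_familyMaximalFn hB hx

/-- The constant in the bound `∫ (Mf)^p w ≤ C [w]^(p/(p-1)) ∫ |f|^p w`. -/
noncomputable def weightedConst (p : ℝ) : ℝ≥0 :=
  maximalConst (p / (p - 1)) * maximalConst p

theorem weightedConst_pos (hp : 1 < p) : 0 < weightedConst p :=
  mul_pos (maximalConst_pos (by rw [lt_div_iff₀] <;> linarith)) (maximalConst_pos hp)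

theorem lintegral_familyMaximalFn_rpow_withDensity_le (hp : 1 < p) (hW : Measurable W)
    (hW0 : ∀ x, W x ≠ 0) (hWt : ∀ x, W x ≠ ∞) (hF : Measurable F) (hA : A ≠ ∞)
    (hAp : ∀ B : Set K, IsBall B → ((μ B)⁻¹ * ∫⁻ x in B, W x ∂μ) *
      ((μ B)⁻¹ * ∫⁻ x in B, W x ^ (-(1 / (p - 1))) ∂μ) ^ (p - 1) ≤ A) :
    ∫⁻ x, familyMaximalFn {B : Set K | IsBall B} μ F x ^ p ∂(μ.withDensity W) ≤
      A ^ (p / (p - 1)) * weightedConst p * ∫⁻ x, F x ^ p ∂(μ.withDensity W) := by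
  have hp0 : 0 < p := by linarith
  have hp1 : 0 < p - 1 := by linarith
  have hq : 1 < p / (p - 1) := by rw [lt_div_iff₀] <;> linarith
  have hq0 : 0 < p / (p - 1) := by linarith
  have := sigmaFinite_of_isAddHaarMeasure μ
  have hc := countable_setOf_isBall K
  have hm : ∀ B ∈ {B : Set K | IsBall B}, MeasurableSet B := fun B hB => IsBall.measurableSet hB
  have hkey := familyMaximalFn_rpow_le hp hW hW0 hWt hF hA hAp
  set S : K → ℝ≥0∞ := fun z => W z ^ (-(1 / (p - 1))) with hS
  have hSm : Measurable S := hW.pow_const _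
  set N : K → ℝ≥0∞ := familyMaximalFn {B : Set K | IsBall B} (μ.withDensity S)
    (fun z => F z * (S z)⁻¹) with hN
  have hNm : Measurable N := measurable_familyMaximalFn hc hm
  set G : K → ℝ≥0∞ := fun y => N y ^ (p - 1) * (W y)⁻¹ with hG
  have hGm : Measurable G := (hNm.pow_const _).mul hW.inv
  have hGW : ∀ y, W y * G y ^ (p / (p - 1)) = S y * N y ^ p := by
    intro y
    rw [hG, ENNReal.mul_rpow_of_nonneg _ _ hq0.le, ← ENNReal.rpow_mul,
      mul_div_cancel₀ _ hp1.ne', ← ENNReal.rpow_neg_one (W y), ← ENNReal.rpow_mul,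
      mul_comm (N y ^ p),
      ← mul_assoc]
    congr 1
    conv_lhs => rw [← ENNReal.rpow_one (W y), ← ENNReal.rpow_mul]
    rw [← ENNReal.rpow_add _ _ (hW0 y) (hWt y)]
    congr 1
    field_simp
    ring
  have hFS : ∀ y, S y * (F y * (S y)⁻¹) ^ p = W y * F y ^ p := by
    intro y
    rw [ENNReal.mul_rpow_of_nonneg _ _ hp0.le, mul_comm (F y ^ p), ← mul_assoc]
    congr 1
    simp only [hS]
    rw [← ENNReal.rpow_neg, ← ENNReal.rpow_mul, ← ENNReal.rpow_add _ _ (hW0 y) (hWt y)]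
    conv_rhs => rw [← ENNReal.rpow_one (W y)]
    congr 1
    field_simp
    ring
  calc ∫⁻ x, familyMaximalFn {B : Set K | IsBall B} μ F x ^ p ∂(μ.withDensity W)
      ≤ ∫⁻ x, A ^ (p / (p - 1)) * familyMaximalFn {B : Set K | IsBall B} (μ.withDensity W) G x ^
          (p / (p - 1)) ∂(μ.withDensity W) := by
        refine lintegral_mono fun x => ?_
        rw [← ENNReal.mul_rpow_of_nonneg _ _ hq0.le]
        calc familyMaximalFn {B : Set K | IsBall B} μ F x ^ p
            = (familyMaximalFn {B : Set K | IsBall B} μ F x ^ (p - 1)) ^ (p / (p - 1)) := by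
              rw [← ENNReal.rpow_mul, mul_div_cancel₀ _ hp1.ne']
          _ ≤ _ := by
              gcongr
              exact hkey x
    _ = A ^ (p / (p - 1)) * ∫⁻ x, familyMaximalFn {B : Set K | IsBall B} (μ.withDensity W) G x ^
          (p / (p - 1)) ∂(μ.withDensity W) :=
        lintegral_const_mul _ ((measurable_familyMaximalFn hc hm).pow_const _)
    _ ≤ A ^ (p / (p - 1)) * (maximalConst (p / (p - 1)) *
          ∫⁻ x, G x ^ (p / (p - 1)) ∂(μ.withDensity W)) := by
        gcongr
        exact lintegral_familyMaximalFn_rpow_le hc isLaminar_isBall hm hGm hq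
    _ = A ^ (p / (p - 1)) * (maximalConst (p / (p - 1)) * ∫⁻ x, N x ^ p ∂(μ.withDensity S)) := by
        rw [lintegral_withDensity_eq_lintegral_mul _ hW (hGm.pow_const _),
          lintegral_withDensity_eq_lintegral_mul _ hSm (hNm.pow_const _)]
        simp only [Pi.mul_apply, hGW]
    _ ≤ A ^ (p / (p - 1)) * (maximalConst (p / (p - 1)) * (maximalConst p *
          ∫⁻ x, (F x * (S x)⁻¹) ^ p ∂(μ.withDensity S))) := by
        gcongr
        exact lintegral_familyMaximalFn_rpow_le hc isLaminar_isBall hm (hF.mul hSm.inv) hp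
    _ = A ^ (p / (p - 1)) * weightedConst p * ∫⁻ x, F x ^ p ∂(μ.withDensity W) := by
        rw [lintegral_withDensity_eq_lintegral_mul _ hW (hF.pow_const _),
          lintegral_withDensity_eq_lintegral_mul (g := fun x => (F x * (S x)⁻¹) ^ p) _ hSm
            ((hF.mul hSm.inv).pow_const _)]
        simp only [Pi.mul_apply, hFS, weightedConst, ENNReal.coe_mul]
        ring

omit [BorelSpace K] [μ.IsAddHaarMeasure] [TopologicalSpace K] [IsNonarchimedeanLocalField K] in
theorem apQuantity_le_apChar (p : ℝ) (w : K → ℝ) {B : Set K} (hB : IsBall B) :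
    apQuantity μ p w B ≤ apChar μ p w :=
  le_sInf fun _ hC => hC B hB

omit [BorelSpace K] [μ.IsAddHaarMeasure] [IsNonarchimedeanLocalField K] in
theorem IsAp.apChar_ne_top {w : K → ℝ} (hw : IsAp μ p w) : apChar μ p w ≠ ∞ := by
  obtain ⟨-, C, -, hC⟩ := hw
  exact ne_top_of_le_ne_top ENNReal.coe_ne_top (sInf_le (a := (C : ℝ≥0∞)) hC)

omit [BorelSpace K] [μ.IsAddHaarMeasure] in
theorem IsWeight.exists_measurable {w : K → ℝ} (hw : IsWeight μ w) :
    ∃ W : K → ℝ≥0∞, Measurable W ∧ (∀ x, W x ≠ 0) ∧ (∀ x, W x ≠ ∞) ∧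
      ∀ᵐ x ∂μ, 0 < w x ∧ ENNReal.ofReal (w x) = W x := by
  have := secondCountableTopology K
  have hm : AEStronglyMeasurable w μ := hw.locallyIntegrable.aestronglyMeasurable
  let u := hm.mk w
  have hu : Measurable u := hm.stronglyMeasurable_mk.measurable
  refine ⟨fun x => if 0 < u x then ENNReal.ofReal (u x) else 1, ?_, ?_, ?_, ?_⟩
  · exact Measurable.ite (measurableSet_lt measurable_const hu) hu.ennreal_ofReal measurable_const
  · intro x
    dsimp only
    split_ifs with h
    · simpa using h
    · exact one_ne_zero
  · intro x
    dsimp only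
    split_ifs <;> simp
  · filter_upwards [hm.ae_eq_mk, hw.pos] with x hx h0
    have h1 : w x = u x := hx
    rw [← h1, if_pos h0]
    exact ⟨h0, rfl⟩

omit [μ.IsAddHaarMeasure] in
theorem measurable_maximalFn (f : K → ℂ) :
    Measurable (maximalFn μ f) :=
  measurable_familyMaximalFn (𝓑 := {B : Set K | IsBall B}) (ν := μ) (g := fun y => ‖f y‖ₑ)
    (countable_setOf_isBall K) fun _ hB => IsBall.measurableSet hB

theorem lintegral_maximalFn_rpow_le (hp : 1 < p) {w : K → ℝ} (hw : IsAp μ p w) {f : K → ℂ}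
    (hf : AEStronglyMeasurable f (weighted μ w)) :
    ∫⁻ x, maximalFn μ f x ^ p ∂(weighted μ w) ≤
      apChar μ p w ^ (p / (p - 1)) * weightedConst p * ∫⁻ x, ‖f x‖ₑ ^ p ∂(weighted μ w) := by
  obtain ⟨W, hW, hW0, hWt, hwW⟩ := hw.1.exists_measurable
  have hν : weighted μ w = μ.withDensity W := withDensity_congr_ae (hwW.mono fun x hx => hx.2)
  rw [hν] at hf ⊢
  let F := hf.enorm.mk _
  have hF : Measurable F := hf.enorm.measurable_mk
  have hfF : (fun x => ‖f x‖ₑ) =ᵐ[μ.withDensity W] F := hf.enorm.ae_eq_mk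
  have hfFμ : (fun x => ‖f x‖ₑ) =ᵐ[μ] F :=
    (withDensity_absolutelyContinuous' hW.aemeasurable (Eventually.of_forall hW0)).ae_le hfF
  have hmax : maximalFn μ f = familyMaximalFn {B : Set K | IsBall B} μ F := by
    ext x
    unfold maximalFn familyMaximalFn
    refine iSup_congr fun B => iSup_congr fun _ => iSup_congr fun _ => ?_
    rw [lintegral_congr_ae (ae_restrict_of_ae hfFμ)]
  have hpow : ∫⁻ x, ‖f x‖ₑ ^ p ∂(μ.withDensity W) = ∫⁻ x, F x ^ p ∂(μ.withDensity W) :=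
    lintegral_congr_ae (hfF.fun_comp fun y => y ^ p)
  rw [hmax, hpow]
  refine lintegral_familyMaximalFn_rpow_withDensity_le hp hW hW0 hWt hF hw.apChar_ne_top ?_
  intro B hB
  refine le_trans (le_of_eq ?_) (apQuantity_le_apChar p w hB)
  have h1 : ∫⁻ x in B, W x ∂μ = ∫⁻ x in B, ENNReal.ofReal (w x) ∂μ :=
    lintegral_congr_ae (ae_restrict_of_ae (hwW.mono fun x hx => hx.2.symm))
  have h2 : ∫⁻ x in B, W x ^ (-(1 / (p - 1))) ∂μ =
      ∫⁻ x in B, ENNReal.ofReal (w x ^ (-(1 / (p - 1)))) ∂μ :=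
    lintegral_congr_ae (ae_restrict_of_ae (hwW.mono fun x hx => by
      dsimp only
      rw [← hx.2, ENNReal.ofReal_rpow_of_pos hx.1]))
  rw [apQuantity, h1, h2]

omit [Field K] [ValuativeRel K] [TopologicalSpace K] [IsNonarchimedeanLocalField K] [BorelSpace K]
  [μ.IsAddHaarMeasure] in
theorem weightedNorm_eq (hp : 0 < p) {E : Type*} [TopologicalSpace E] [ContinuousENorm E]
    (w : K → ℝ) (f : K → E) :
    weightedNorm μ p w f = (∫⁻ x, ‖f x‖ₑ ^ p ∂(weighted μ w)) ^ (1 / p) := by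
  rw [weightedNorm, eLpNorm_eq_lintegral_rpow_enorm_toReal (by simpa using hp)
    ENNReal.ofReal_ne_top, ENNReal.toReal_ofReal hp.le]

theorem weightedNorm_maximalFn_le (hp : 1 < p) {w : K → ℝ} (hw : IsAp μ p w) {f : K → ℂ}
    (hf : AEStronglyMeasurable f (weighted μ w)) :
    weightedNorm μ p w (maximalFn μ f) ≤
      ((weightedConst p ^ (1 / p) : ℝ≥0) : ℝ≥0∞) * apChar μ p w ^ (1 / (p - 1)) *
        weightedNorm μ p w f := by
  have hp0 : 0 < p := by linarith
  have hp1 : 0 < p - 1 := by linarith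
  rw [weightedNorm_eq hp0, weightedNorm_eq hp0]
  simp only [enorm_eq_self]
  refine (ENNReal.rpow_le_rpow (lintegral_maximalFn_rpow_le hp hw hf) (by positivity)).trans_eq ?_
  rw [ENNReal.mul_rpow_of_nonneg _ _ (by positivity),
    ENNReal.mul_rpow_of_nonneg _ _ (by positivity), ← ENNReal.rpow_mul, ENNReal.coe_rpow_of_nonneg _ (by positivity),
    show p / (p - 1) * (1 / p) = 1 / (p - 1) by field_simp]
  ring

theorem memWeighted_maximalFn (hp : 1 < p) {w : K → ℝ} (hw : IsAp μ p w) {f : K → ℂ}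
    (hf : MemWeighted μ p w f) : MemWeighted μ p w (maximalFn μ f) := by
  have hp1 : 0 < p - 1 := by linarith
  refine ⟨(measurable_maximalFn f).aestronglyMeasurable, ?_⟩
  refine (weightedNorm_maximalFn_le hp hw hf.1).trans_lt ?_
  refine ENNReal.mul_lt_top (ENNReal.mul_lt_top ENNReal.coe_lt_top ?_) hf.2
  exact ENNReal.rpow_lt_top_of_nonneg (by positivity) hw.apChar_ne_top

omit [BorelSpace K] [μ.IsAddHaarMeasure] in
theorem absolutelyContinuous_weighted {w : K → ℝ} (hw : IsWeight μ w) : μ ≪ weighted μ w := by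
  have := secondCountableTopology K
  exact withDensity_absolutelyContinuous'
    hw.locallyIntegrable.aestronglyMeasurable.aemeasurable.ennreal_ofReal
    (hw.pos.mono fun x hx => by simpa using hx)

theorem locallyIntegrable_of_memWeighted (hp : 1 < p) {w : K → ℝ} (hw : IsAp μ p w) {f : K → ℂ}
    (hf : MemWeighted μ p w f) : LocallyIntegrable f μ := by
  have hp0 : 0 < p := by linarith
  have hac := absolutelyContinuous_weighted hw.1
  have hM : ∀ᵐ x ∂μ, maximalFn μ f x ≠ ∞ := by
    have h := (memWeighted_maximalFn hp hw hf).2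
    rw [eLpNorm_lt_top_iff_lintegral_rpow_enorm_lt_top (by simpa using hp0) ENNReal.ofReal_ne_top,
      ENNReal.toReal_ofReal hp0.le] at h
    simp only [enorm_eq_self] at h
    refine hac.ae_le ((ae_lt_top ((measurable_maximalFn f).pow_const p) h.ne).mono fun x hx => ?_)
    intro h0
    rw [h0, ENNReal.top_rpow_of_pos hp0] at hx
    exact lt_irrefl _ hx
  intro x
  have hB : IsBall (ball x (1 : K)) := isBall_ball x one_ne_zero
  refine ⟨ball x 1, hB.isOpen.mem_nhds (mem_ball_self x 1), (hf.1.mono_ac hac).restrict, ?_⟩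
  obtain ⟨y, hy, hyM⟩ : ∃ y ∈ ball x (1 : K), maximalFn μ f y ≠ ∞ := by
    by_contra! h
    refine hB.measure_ne_zero (μ := μ) (measure_mono_null (fun y hy => ?_) hM)
    simpa using h y hy
  have hle : (μ (ball x (1 : K)))⁻¹ * ∫⁻ z in ball x 1, ‖f z‖ₑ ∂μ ≤ maximalFn μ f y :=
    le_familyMaximalFn (𝓑 := {B : Set K | IsBall B}) (g := fun z => ‖f z‖ₑ) hB hy
  rw [hasFiniteIntegral_iff_enorm]
  by_contra htop
  rw [not_lt_top_iff] at htop
  rw [htop, ENNReal.mul_top (ENNReal.inv_ne_zero.2 hB.measure_ne_top)] at hle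
  exact hyM (top_le_iff.1 hle)

theorem maximalNorm_le (hp : 1 < p) {w : K → ℝ} (hw : IsAp μ p w) :
    maximalNorm μ p w ≤
      ((weightedConst p ^ (1 / p) : ℝ≥0) : ℝ≥0∞) * apChar μ p w ^ (1 / (p - 1)) :=
  sInf_le fun _ hf => weightedNorm_maximalFn_le hp hw hf.1

end Upper

/-! ### Power weights -/

section Power

variable {K : Type*} [Field K] [ValuativeRel K] [TopologicalSpace K] [IsNonarchimedeanLocalField K]

variable (K) in
theorem exists_absV_lt_one : ∃ b : K, b ≠ 0 ∧
    ValuativeRel.valuation K b < 1 ∧ absV b < 1 := by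
  obtain ⟨b, hb, hb1⟩ := Valuation.IsNontrivial.exists_lt_one (v := ValuativeRel.valuation K)
  refine ⟨b, hb, hb1, ?_⟩
  rw [← absV_one (K := K)]
  exact absV_lt_absV (by simpa using hb1)

theorem absV_le_one_of_mem_ball {x : K} (hx : x ∈ ball 0 (1 : K)) : absV x ≤ 1 := by
  rw [← absV_one (K := K)]
  exact absV_le_absV (mem_ball_zero.1 hx)

omit [TopologicalSpace K] [IsNonarchimedeanLocalField K] in
theorem ne_zero_of_notMem_ball {x b : K} (hx : x ∉ ball 0 b) : x ≠ 0 := by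
  rintro rfl
  exact hx (mem_ball_self 0 b)

theorem absV_le_of_notMem_ball {x b : K} (hx : x ∉ ball 0 b) : absV b ≤ absV x :=
  absV_le_absV (le_of_not_ge fun h => hx (mem_ball_zero.2 h))

/-- The function `|x|^(θ-1)` with values in `[0, ∞]`. -/
noncomputable def dualPower (θ : ℝ) (x : K) : ℝ≥0∞ :=
  ENNReal.ofReal (absV x ^ (θ - 1))

theorem powerWeight_rpow {p : ℝ} (hp : 1 < p) (θ : ℝ) (x : K) :
    ENNReal.ofReal (powerWeight p θ x ^ (-(1 / (p - 1)))) = dualPower θ x := by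
  have hp1 : p - 1 ≠ 0 := by linarith
  rw [powerWeight, dualPower, ← Real.rpow_mul (absV_nonneg x)]
  congr 2
  field_simp
  ring

theorem dualPower_mul (θ : ℝ) (x y : K) :
    dualPower θ (x * y) = ENNReal.ofReal (absV x ^ (θ - 1)) * dualPower θ y := by
  rw [dualPower, dualPower, absV_mul, Real.mul_rpow (absV_nonneg x) (absV_nonneg y),
    ENNReal.ofReal_mul (Real.rpow_nonneg (absV_nonneg x) _)]

theorem ofReal_absV_mul_rpow {a : K} (ha : a ≠ 0) (θ : ℝ) :
    ENNReal.ofReal (absV a) * ENNReal.ofReal (absV a ^ (θ - 1)) =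
      ENNReal.ofReal (absV a ^ θ) := by
  rw [← ENNReal.ofReal_mul (absV_nonneg a), Real.rpow_sub_one (absV_pos ha).ne',
    mul_div_cancel₀ _ (absV_pos ha).ne']

theorem one_le_dualPower {θ : ℝ} (hθ : θ < 1) {x : K} (hx : x ∈ ball 0 (1 : K)) (h0 : x ≠ 0) :
    1 ≤ dualPower θ x := by
  rw [dualPower, ENNReal.one_le_ofReal]
  exact Real.one_le_rpow_of_pos_of_le_one_of_nonpos (absV_pos h0) (absV_le_one_of_mem_ball hx)
    (by linarith)

theorem enorm_extremalFn (θ : ℝ) (x : K) :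
    ‖extremalFn θ x‖ₑ = (ball 0 (1 : K)).indicator (dualPower θ) x := by
  rw [extremalFn, integer_eq_ball]
  by_cases hx : x ∈ ball 0 (1 : K)
  · rw [Set.indicator_of_mem hx, Set.indicator_of_mem hx, dualPower, ← ofReal_norm,
      Complex.norm_real, Real.norm_of_nonneg (Real.rpow_nonneg (absV_nonneg x) _)]
  · rw [Set.indicator_of_notMem hx, Set.indicator_of_notMem hx, enorm_zero]

theorem dualPower_rpow_mul_powerWeight (p θ : ℝ) {x : K} (hx : x ≠ 0) :
    ENNReal.ofReal (powerWeight p θ x) * dualPower θ x ^ p = dualPower θ x := by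
  have h := absV_pos hx
  rw [dualPower, powerWeight, ENNReal.ofReal_rpow_of_pos (Real.rpow_pos_of_pos h _),
    ← ENNReal.ofReal_mul (Real.rpow_nonneg h.le _), ← Real.rpow_mul h.le, ← Real.rpow_add h]
  congr 2
  ring

theorem powerWeight_mul_dualPower_rpow (p θ : ℝ) {a : K} (ha : a ≠ 0) :
    ENNReal.ofReal (powerWeight p θ a) * dualPower θ a ^ (p - 1) = 1 := by
  have h := absV_pos ha
  rw [dualPower, powerWeight, ENNReal.ofReal_rpow_of_pos (Real.rpow_pos_of_pos h _),
    ← ENNReal.ofReal_mul (Real.rpow_nonneg h.le _), ← Real.rpow_mul h.le, ← Real.rpow_add h,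
    show (p - 1) * (1 - θ) + (θ - 1) * (p - 1) = 0 by ring, Real.rpow_zero, ENNReal.ofReal_one]

variable [MeasurableSpace K] [BorelSpace K]

theorem measurable_dualPower (θ : ℝ) : Measurable (dualPower θ : K → ℝ≥0∞) :=
  (measurable_absV.pow_const _).ennreal_ofReal

theorem measurable_powerWeight (p θ : ℝ) : Measurable (powerWeight p θ : K → ℝ) :=
  measurable_absV.pow_const _

theorem measurable_extremalFn (θ : ℝ) : Measurable (extremalFn θ : K → ℂ) := by
  rw [extremalFn, integer_eq_ball]
  exact (Complex.measurable_ofReal.comp (measurable_absV.pow_const _)).indicator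
    (isBall_ball 0 one_ne_zero).measurableSet

variable (μ : Measure K) [μ.IsAddHaarMeasure]

theorem setLIntegral_ball_zero {a : K} (ha : a ≠ 0) (f : K → ℝ≥0∞) :
    ∫⁻ x in ball 0 a, f x ∂μ =
      ENNReal.ofReal (absV a) * ∫⁻ x in ball 0 (1 : K), f (a * x) ∂μ := by
  rw [← lintegral_indicator (isBall_ball 0 ha).measurableSet,
    ← lintegral_indicator (isBall_ball 0 one_ne_zero).measurableSet, ← lintegral_comp_mul μ ha]
  congr 1
  refine lintegral_congr fun x => ?_
  have : a * x ∈ ball 0 a ↔ x ∈ ball 0 (1 : K) := by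
    rw [← preimage_mul_ball_zero (b := (1 : K)) ha, mul_one, Set.mem_preimage]
  by_cases hx : x ∈ ball 0 (1 : K)
  · rw [Set.indicator_of_mem hx, Set.indicator_of_mem (this.2 hx)]
  · rw [Set.indicator_of_notMem hx, Set.indicator_of_notMem (mt this.1 hx)]

theorem setLIntegral_dualPower_ball {a : K} (ha : a ≠ 0) (θ : ℝ) :
    ∫⁻ x in ball 0 a, dualPower θ x ∂μ =
      ENNReal.ofReal (absV a ^ θ) * ∫⁻ x in ball 0 (1 : K), dualPower θ x ∂μ := by
  rw [setLIntegral_ball_zero μ ha]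
  simp only [dualPower_mul]
  rw [lintegral_const_mul _ (measurable_dualPower θ), ← mul_assoc, ofReal_absV_mul_rpow ha]

omit [μ.IsAddHaarMeasure] in
theorem setLIntegral_ball_one_eq_add {b : K} (hb : b ≠ 0)
    (hb1 : ValuativeRel.valuation K b < 1) (f : K → ℝ≥0∞) :
    ∫⁻ x in ball 0 (1 : K), f x ∂μ =
      ∫⁻ x in ball 0 (1 : K) \ ball 0 b, f x ∂μ + ∫⁻ x in ball 0 b, f x ∂μ := by
  have hsub : ball 0 b ⊆ ball 0 (1 : K) :=
    ball_subset_ball (by simpa using hb1.le) (mem_ball_self 0 1)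
  have := lintegral_inter_add_sdiff (μ := μ) f (ball 0 (1 : K))
    (isBall_ball 0 hb).measurableSet
  rw [← this, Set.inter_eq_self_of_subset_right hsub, add_comm]

theorem setLIntegral_dualPower_ne_top {θ : ℝ} (h0 : 0 < θ) (h1 : θ < 1) :
    ∫⁻ x in ball 0 (1 : K), dualPower θ x ∂μ ≠ ∞ := by
  obtain ⟨b, hb, hbv, hb1⟩ := exists_absV_lt_one K
  have hbp := absV_pos hb
  have hm : μ (ball 0 (1 : K)) ≠ ∞ := (isBall_ball 0 one_ne_zero).measure_ne_top
  set r := ENNReal.ofReal (absV b ^ θ) with hr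
  have hr1 : r < 1 := by
    rw [hr, ENNReal.ofReal_lt_one]
    exact Real.rpow_lt_one hbp.le hb1 h0
  have hbθ : 1 ≤ ENNReal.ofReal (absV b ^ (θ - 1)) := by
    rw [ENNReal.one_le_ofReal]
    exact Real.one_le_rpow_of_pos_of_le_one_of_nonpos hbp hb1.le (by linarith)
  set D := ENNReal.ofReal (absV b ^ (θ - 1)) * μ (ball 0 (1 : K)) with hD
  have hDt : D ≠ ∞ := ENNReal.mul_ne_top ENNReal.ofReal_ne_top hm
  have hT : ∀ n : ℕ, ∫⁻ x in ball 0 (1 : K), min (dualPower θ x) n ∂μ ≤ D / (1 - r) := by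
    intro n
    set T := ∫⁻ x in ball 0 (1 : K), min (dualPower θ x) n ∂μ with hTdef
    have hTt : T ≠ ∞ := by
      refine ne_top_of_le_ne_top (ENNReal.mul_ne_top (ENNReal.natCast_ne_top n) hm) ?_
      rw [← setLIntegral_const]
      exact lintegral_mono fun x => min_le_right _ _
    have hle : T ≤ D + r * T := by
      refine (setLIntegral_ball_one_eq_add μ hb hbv _).trans_le ?_
      refine add_le_add ?_ ?_
      · calc ∫⁻ x in ball 0 (1 : K) \ ball 0 b, min (dualPower θ x) n ∂μ
            ≤ ∫⁻ x in ball 0 (1 : K) \ ball 0 b, ENNReal.ofReal (absV b ^ (θ - 1)) ∂μ := by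
              refine setLIntegral_mono measurable_const fun x hx => (min_le_left _ _).trans ?_
              exact ENNReal.ofReal_le_ofReal (Real.rpow_le_rpow_of_nonpos hbp
                (absV_le_of_notMem_ball hx.2) (by linarith))
          _ ≤ D := by
              rw [setLIntegral_const]
              exact mul_le_mul_right (measure_mono Set.sdiff_subset) _
      · rw [setLIntegral_ball_zero μ hb]
        calc ENNReal.ofReal (absV b) * ∫⁻ x in ball 0 (1 : K), min (dualPower θ (b * x)) n ∂μ
            ≤ ENNReal.ofReal (absV b) * ∫⁻ x in ball 0 (1 : K),
                ENNReal.ofReal (absV b ^ (θ - 1)) * min (dualPower θ x) n ∂μ := by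
              gcongr with x
              rw [dualPower_mul, mul_min]
              gcongr
              exact le_mul_of_one_le_left' hbθ
          _ = r * T := by
              rw [lintegral_const_mul _ ((measurable_dualPower θ).min measurable_const),
                ← mul_assoc, ofReal_absV_mul_rpow hb]
    rw [ENNReal.le_div_iff_mul_le (Or.inl (tsub_pos_of_lt hr1).ne')
      (Or.inl (ENNReal.sub_ne_top ENNReal.one_ne_top)), ENNReal.mul_sub fun _ _ => hTt, mul_one,
      tsub_le_iff_right, mul_comm T r]
    exact hle
  have hsup : ∫⁻ x in ball 0 (1 : K), dualPower θ x ∂μ =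
      ⨆ n : ℕ, ∫⁻ x in ball 0 (1 : K), min (dualPower θ x) n ∂μ := by
    rw [← lintegral_iSup fun n => (measurable_dualPower θ).min measurable_const]
    · refine lintegral_congr fun x => ?_
      rw [← inf_iSup_eq, ENNReal.iSup_natCast, inf_top_eq]
    · intro k l hkl x
      dsimp only
      gcongr
  rw [hsup]
  exact ne_top_of_le_ne_top (ENNReal.div_ne_top hDt (tsub_pos_of_lt hr1).ne') (iSup_le hT)

/-- The average of `|x|^(θ-1)` over the ring of integers. -/
noncomputable def dualAverage (θ : ℝ) : ℝ≥0∞ :=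
  (μ (ball 0 (1 : K)))⁻¹ * ∫⁻ x in ball 0 (1 : K), dualPower θ x ∂μ

theorem dualAverage_ne_top {θ : ℝ} (h0 : 0 < θ) (h1 : θ < 1) : dualAverage μ θ ≠ ∞ :=
  ENNReal.mul_ne_top (ENNReal.inv_ne_top.2 (isBall_ball 0 one_ne_zero).measure_ne_zero)
    (setLIntegral_dualPower_ne_top μ h0 h1)

theorem measure_le_setLIntegral_dualPower {θ : ℝ} (h1 : θ < 1) :
    μ (ball 0 (1 : K)) ≤ ∫⁻ x in ball 0 (1 : K), dualPower θ x ∂μ := by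
  rw [← setLIntegral_one]
  refine lintegral_mono_ae ?_
  filter_upwards [ae_restrict_mem (isBall_ball (0 : K) one_ne_zero).measurableSet,
    ae_restrict_of_ae (ae_ne_zero μ)] with x hx hx0
  exact one_le_dualPower h1 hx hx0

theorem one_le_dualAverage {θ : ℝ} (h1 : θ < 1) : 1 ≤ dualAverage μ θ := by
  have hB : IsBall (ball 0 (1 : K)) := isBall_ball 0 one_ne_zero
  rw [← ENNReal.inv_mul_cancel (hB.measure_ne_zero (μ := μ)) hB.measure_ne_top]
  exact mul_le_mul_right (measure_le_setLIntegral_dualPower μ h1) _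

theorem average_dualPower_ball {a : K} (ha : a ≠ 0) (θ : ℝ) :
    (μ (ball 0 a))⁻¹ * ∫⁻ x in ball 0 a, dualPower θ x ∂μ =
      ENNReal.ofReal (absV a ^ (θ - 1)) * dualAverage μ θ := by
  have ha0 : ENNReal.ofReal (absV a) ≠ 0 := by simpa using absV_pos ha
  rw [setLIntegral_dualPower_ball μ ha, measure_ball_zero μ ha,
    ENNReal.mul_inv (Or.inl ha0) (Or.inl ENNReal.ofReal_ne_top), ← ofReal_absV_mul_rpow ha,
    dualAverage]
  calc _ = ((ENNReal.ofReal (absV a))⁻¹ * ENNReal.ofReal (absV a)) *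
        (ENNReal.ofReal (absV a ^ (θ - 1)) * ((μ (ball 0 (1 : K)))⁻¹ *
          ∫⁻ x in ball 0 (1 : K), dualPower θ x ∂μ)) := by ring
    _ = _ := by rw [ENNReal.inv_mul_cancel ha0 ENNReal.ofReal_ne_top, one_mul]

theorem dualAverage_mul_enorm_extremalFn_le (θ : ℝ) (x : K) (hθ : θ < 1) :
    dualAverage μ θ * ‖extremalFn θ x‖ₑ ≤ maximalFn μ (extremalFn θ) x := by
  rw [enorm_extremalFn]
  by_cases hx : x ∈ ball 0 (1 : K)
  swap
  · rw [Set.indicator_of_notMem hx, mul_zero]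
    exact zero_le
  rw [Set.indicator_of_mem hx]
  rcases eq_or_ne x 0 with rfl | hx0
  · rw [dualPower, absV_zero, Real.zero_rpow (by linarith), ENNReal.ofReal_zero, mul_zero]
    exact zero_le
  have hsub : ball 0 x ⊆ ball 0 (1 : K) :=
    ball_subset_ball (mem_ball_zero.1 hx) (mem_ball_self 0 1)
  rw [mul_comm, dualPower, ← average_dualPower_ball μ hx0]
  refine le_trans (le_of_eq ?_) (le_familyMaximalFn (𝓑 := {B : Set K | IsBall B})
    (g := fun z => ‖extremalFn θ z‖ₑ) (isBall_ball 0 hx0) (mem_ball_zero.2 le_rfl))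
  congr 1
  refine setLIntegral_congr_fun (isBall_ball 0 hx0).measurableSet fun z hz => ?_
  rw [enorm_extremalFn, Set.indicator_of_mem (hsub hz)]

variable {p : ℝ}

omit [BorelSpace K] [μ.IsAddHaarMeasure] in
theorem apQuantity_powerWeight (hp : 1 < p) (θ : ℝ) (B : Set K) :
    apQuantity μ p (powerWeight p θ) B =
      ((μ B)⁻¹ * ∫⁻ x in B, ENNReal.ofReal (powerWeight p θ x) ∂μ) *
        ((μ B)⁻¹ * ∫⁻ x in B, dualPower θ x ∂μ) ^ (p - 1) := by
  simp only [apQuantity, powerWeight_rpow hp]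

theorem apQuantity_powerWeight_le (hp : 1 < p) {θ : ℝ} (hθ : θ < 1) {B : Set K}
    (hB : IsBall B) : apQuantity μ p (powerWeight p θ) B ≤ dualAverage μ θ ^ (p - 1) := by
  have hp1 : 0 < p - 1 := by linarith
  have hconst : ∀ c : ℝ≥0∞, (μ B)⁻¹ * ∫⁻ _ in B, c ∂μ = c := by
    intro c
    rw [setLIntegral_const, mul_comm c, ← mul_assoc,
      ENNReal.inv_mul_cancel hB.measure_ne_zero hB.measure_ne_top, one_mul]
  rw [apQuantity_powerWeight μ hp]
  obtain ⟨h, a, ha, rfl⟩ := hB.exists_eq_ball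
  by_cases h0 : (0 : K) ∈ ball h a
  · rw [← ball_eq_ball h0] at hconst ⊢
    calc _ ≤ ENNReal.ofReal (powerWeight p θ a) *
          (ENNReal.ofReal (absV a ^ (θ - 1)) * dualAverage μ θ) ^ (p - 1) := by
          rw [average_dualPower_ball μ ha]
          gcongr
          rw [← hconst (ENNReal.ofReal (powerWeight p θ a))]
          refine mul_le_mul_right (setLIntegral_mono measurable_const fun x hx => ?_) _
          refine ENNReal.ofReal_le_ofReal (Real.rpow_le_rpow (absV_nonneg x)
            (absV_le_absV (mem_ball_zero.1 hx)) (mul_nonneg hp1.le (by linarith)))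
      _ = dualAverage μ θ ^ (p - 1) := by
          rw [ENNReal.mul_rpow_of_nonneg _ _ hp1.le, ← mul_assoc]
          have := powerWeight_mul_dualPower_rpow p θ ha
          rw [dualPower] at this
          rw [this, one_mul]
  · have hh : h ≠ 0 := by
      rintro rfl
      exact h0 (mem_ball_self _ _)
    have hbm : MeasurableSet (ball h a) := hB.measurableSet
    have hV : ∀ x ∈ ball h a, absV x = absV h := fun x hx =>
      absV_congr (valuation_eq_of_mem_ball h0 hx)
    have h1 : ∫⁻ x in ball h a, ENNReal.ofReal (powerWeight p θ x) ∂μ =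
        ∫⁻ _ in ball h a, ENNReal.ofReal (powerWeight p θ h) ∂μ :=
      setLIntegral_congr_fun hbm fun x hx => by simp only [powerWeight, hV x hx]
    have h2 : ∫⁻ x in ball h a, dualPower θ x ∂μ = ∫⁻ _ in ball h a, dualPower θ h ∂μ :=
      setLIntegral_congr_fun hbm fun x hx => by simp only [dualPower, hV x hx]
    rw [h1, h2, hconst, hconst, powerWeight_mul_dualPower_rpow p θ hh]
    exact ENNReal.one_le_rpow (one_le_dualAverage μ hθ) hp1

theorem isWeight_powerWeight (hp : 1 < p) {θ : ℝ} (hθ : θ < 1) :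
    IsWeight μ (powerWeight p θ : K → ℝ) := by
  refine ⟨fun x => ?_, (ae_ne_zero μ).mono fun x hx => Real.rpow_pos_of_pos (absV_pos hx) _⟩
  have hB : IsBall (ball x (1 : K)) := isBall_ball x one_ne_zero
  obtain ⟨c, hc⟩ : ∃ c : ℝ, ∀ y ∈ ball x (1 : K), absV y ≤ c := by
    by_cases h0 : (0 : K) ∈ ball x 1
    · rw [← ball_eq_ball h0]
      exact ⟨1, fun y hy => absV_le_one_of_mem_ball hy⟩
    · exact ⟨absV x, fun y hy => (absV_congr (valuation_eq_of_mem_ball h0 hy)).le⟩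
  refine ⟨ball x 1, hB.isOpen.mem_nhds (mem_ball_self x 1), ?_⟩
  refine Measure.integrableOn_of_bounded (M := c ^ ((p - 1) * (1 - θ))) hB.measure_ne_top
    (measurable_powerWeight p θ).aestronglyMeasurable ?_
  filter_upwards [ae_restrict_mem hB.measurableSet] with y hy
  rw [powerWeight, Real.norm_of_nonneg (Real.rpow_nonneg (absV_nonneg y) _)]
  exact Real.rpow_le_rpow (absV_nonneg y) (hc y hy) (mul_nonneg (by linarith) (by linarith))

theorem isAp_powerWeight (hp : 1 < p) {θ : ℝ} (h0 : 0 < θ) (h1 : θ < 1) :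
    IsAp μ p (powerWeight p θ : K → ℝ) := by
  have hp1 : 0 ≤ p - 1 := by linarith
  have hS := dualAverage_ne_top μ h0 h1
  have hS1 := one_le_dualAverage μ h1
  refine ⟨isWeight_powerWeight μ hp h1, (dualAverage μ θ).toNNReal ^ (p - 1), ?_, fun B hB => ?_⟩
  · exact NNReal.rpow_pos (ENNReal.toNNReal_pos (one_pos.trans_le hS1).ne' hS)
  · rw [ENNReal.coe_rpow_of_nonneg _ hp1, ENNReal.coe_toNNReal hS]
    exact apQuantity_powerWeight_le μ hp h1 hB

theorem apChar_powerWeight_rpow_le (hp : 1 < p) {θ : ℝ} (h1 : θ < 1) :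
    apChar μ p (powerWeight p θ : K → ℝ) ^ (1 / (p - 1)) ≤ dualAverage μ θ := by
  have hp1 : 0 < p - 1 := by linarith
  rw [one_div, ENNReal.rpow_inv_le_iff hp1]
  exact sInf_le (a := dualAverage μ θ ^ (p - 1)) fun B hB => apQuantity_powerWeight_le μ hp h1 hB

theorem lintegral_extremalFn_rpow (hp : 1 < p) (θ : ℝ) :
    ∫⁻ x, ‖(extremalFn θ x : ℂ)‖ₑ ^ p ∂(weighted μ (powerWeight p θ)) =
      ∫⁻ x in ball 0 (1 : K), dualPower θ x ∂μ := by
  rw [weighted, lintegral_withDensity_eq_lintegral_mul _ (measurable_powerWeight p θ).ennreal_ofReal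
    ((measurable_extremalFn θ).enorm.pow_const p),
    ← lintegral_indicator (isBall_ball 0 one_ne_zero).measurableSet]
  refine lintegral_congr_ae ((ae_ne_zero μ).mono fun x hx => ?_)
  simp only [Pi.mul_apply]
  rw [enorm_extremalFn]
  by_cases hxb : x ∈ ball 0 (1 : K)
  · rw [Set.indicator_of_mem hxb, dualPower_rpow_mul_powerWeight p θ hx]
  · rw [Set.indicator_of_notMem hxb, ENNReal.zero_rpow_of_pos (by linarith), mul_zero]

theorem weightedNorm_extremalFn (hp : 1 < p) (θ : ℝ) :
    weightedNorm μ p (powerWeight p θ) (extremalFn θ : K → ℂ) =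
      (∫⁻ x in ball 0 (1 : K), dualPower θ x ∂μ) ^ (1 / p) := by
  rw [weightedNorm_eq (by linarith), lintegral_extremalFn_rpow μ hp]

theorem weightedNorm_extremalFn_pos (hp : 1 < p) {θ : ℝ} (h1 : θ < 1) :
    0 < weightedNorm μ p (powerWeight p θ) (extremalFn θ : K → ℂ) := by
  rw [weightedNorm_extremalFn μ hp]
  refine ENNReal.rpow_pos_of_nonneg ?_ (by positivity)
  exact (pos_iff_ne_zero.2 (isBall_ball 0 one_ne_zero).measure_ne_zero).trans_le
    (measure_le_setLIntegral_dualPower μ h1)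

theorem memWeighted_extremalFn (hp : 1 < p) {θ : ℝ} (h0 : 0 < θ) (h1 : θ < 1) :
    MemWeighted μ p (powerWeight p θ) (extremalFn θ : K → ℂ) := by
  refine ⟨(measurable_extremalFn θ).aestronglyMeasurable, ?_⟩
  have := weightedNorm_extremalFn μ hp θ
  rw [weightedNorm] at this
  rw [this]
  exact ENNReal.rpow_lt_top_of_nonneg (by positivity) (setLIntegral_dualPower_ne_top μ h0 h1)

theorem dualAverage_mul_weightedNorm_le (hp : 1 < p) {θ : ℝ} (h1 : θ < 1) :
    dualAverage μ θ * weightedNorm μ p (powerWeight p θ) (extremalFn θ : K → ℂ) ≤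
      weightedNorm μ p (powerWeight p θ) (maximalFn μ (extremalFn θ)) := by
  have hp0 : 0 < p := by linarith
  rw [weightedNorm_eq hp0, weightedNorm_eq hp0]
  simp only [enorm_eq_self]
  calc dualAverage μ θ * (∫⁻ x, ‖extremalFn θ x‖ₑ ^ p ∂(weighted μ (powerWeight p θ))) ^ (1 / p)
      = (dualAverage μ θ ^ p *
          ∫⁻ x, ‖extremalFn θ x‖ₑ ^ p ∂(weighted μ (powerWeight p θ))) ^ (1 / p) := by
        rw [ENNReal.mul_rpow_of_nonneg _ _ (by positivity), ← ENNReal.rpow_mul,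
          mul_one_div_cancel hp0.ne', ENNReal.rpow_one]
    _ ≤ _ := by
        gcongr
        refine (lintegral_const_mul_le _ _).trans (lintegral_mono fun x => ?_)
        rw [← ENNReal.mul_rpow_of_nonneg _ _ hp0.le]
        gcongr
        exact dualAverage_mul_enorm_extremalFn_le μ θ x h1

theorem apChar_mul_weightedNorm_le (hp : 1 < p) {θ : ℝ} (h1 : θ < 1) :
    apChar μ p (powerWeight p θ : K → ℝ) ^ (1 / (p - 1)) *
        weightedNorm μ p (powerWeight p θ) (extremalFn θ : K → ℂ) ≤
      weightedNorm μ p (powerWeight p θ) (maximalFn μ (extremalFn θ)) :=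
  (mul_le_mul_left (apChar_powerWeight_rpow_le μ hp h1) _).trans
    (dualAverage_mul_weightedNorm_le μ hp h1)

theorem apChar_rpow_le_maximalNorm (hp : 1 < p) {θ : ℝ} (h0 : 0 < θ) (h1 : θ < 1) :
    apChar μ p (powerWeight p θ : K → ℝ) ^ (1 / (p - 1)) ≤
      maximalNorm μ p (powerWeight p θ : K → ℝ) := by
  refine le_sInf fun C hC => ?_
  have hf := memWeighted_extremalFn μ hp h0 h1
  exact (ENNReal.mul_le_mul_iff_left (weightedNorm_extremalFn_pos μ hp h1).ne' hf.2.ne).1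
    ((apChar_mul_weightedNorm_le μ hp h1).trans (hC _ hf))

theorem measure_ball_one_diff_ne_zero {b : K} (hb : b ≠ 0)
    (hb1 : ValuativeRel.valuation K b < 1) : μ (ball 0 (1 : K) \ ball 0 b) ≠ 0 := by
  intro h
  have hB : IsBall (ball 0 (1 : K)) := isBall_ball 0 one_ne_zero
  have habs : absV b < 1 := by
    rw [← absV_one (K := K)]
    exact absV_lt_absV (by simpa using hb1)
  have heq := setLIntegral_ball_one_eq_add μ hb hb1 fun _ => 1
  rw [setLIntegral_one, setLIntegral_one, setLIntegral_one, h, zero_add, measure_ball_zero μ hb]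
    at heq
  have : ENNReal.ofReal (absV b) = 1 := by
    rw [← ENNReal.mul_left_inj (hB.measure_ne_zero (μ := μ)) hB.measure_ne_top, one_mul, ← heq]
  exact habs.ne (ENNReal.ofReal_eq_one.1 this)

theorem le_dualAverage {θ : ℝ} (h0 : 0 < θ) (h1 : θ < 1) {b : K} (hb : b ≠ 0)
    (hbv : ValuativeRel.valuation K b < 1) (hb1 : absV b < 1) :
    ENNReal.ofReal (((μ (ball 0 (1 : K)))⁻¹ * μ (ball 0 (1 : K) \ ball 0 b)).toReal *
      (1 - absV b ^ θ)⁻¹) ≤ dualAverage μ θ := by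
  have hS := dualAverage_ne_top μ h0 h1
  have hbθ : 0 ≤ absV b ^ θ := Real.rpow_nonneg (absV_nonneg b) θ
  have hpos : 0 < 1 - absV b ^ θ := sub_pos.2 (Real.rpow_lt_one (absV_nonneg b) hb1 h0)
  have hle : (μ (ball 0 (1 : K)))⁻¹ * μ (ball 0 (1 : K) \ ball 0 b) +
      ENNReal.ofReal (absV b ^ θ) * dualAverage μ θ ≤ dualAverage μ θ := by
    conv_rhs => rw [dualAverage, setLIntegral_ball_one_eq_add μ hb hbv, mul_add,
      setLIntegral_dualPower_ball μ hb]
    refine add_le_add ?_ (le_of_eq ?_)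
    · gcongr
      rw [← setLIntegral_one]
      refine setLIntegral_mono (measurable_dualPower θ) fun x hx => ?_
      exact one_le_dualPower h1 hx.1 (ne_zero_of_notMem_ball hx.2)
    · rw [dualAverage]
      ring
  have hDt : (μ (ball 0 (1 : K)))⁻¹ * μ (ball 0 (1 : K) \ ball 0 b) ≠ ∞ :=
    ne_top_of_le_ne_top hS (le_self_add.trans hle)
  rw [ENNReal.ofReal_le_iff_le_toReal hS, ← div_eq_mul_inv, div_le_iff₀ hpos]
  have := ENNReal.toReal_mono hS hle
  rw [ENNReal.toReal_add hDt (ENNReal.mul_ne_top ENNReal.ofReal_ne_top hS), ENNReal.toReal_mul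
    (a := ENNReal.ofReal _), ENNReal.toReal_ofReal hbθ] at this
  linarith

theorem tendsto_dualAverage : Tendsto (dualAverage μ) (𝓝[>] 0) (𝓝 ∞) := by
  obtain ⟨b, hb, hbv, hb1⟩ := exists_absV_lt_one K
  have hbp := absV_pos hb
  have hB1 : IsBall (ball 0 (1 : K)) := isBall_ball 0 one_ne_zero
  have hd : 0 < ((μ (ball 0 (1 : K)))⁻¹ * μ (ball 0 (1 : K) \ ball 0 b)).toReal := by
    refine ENNReal.toReal_pos (mul_ne_zero (ENNReal.inv_ne_zero.2 hB1.measure_ne_top)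
      (measure_ball_one_diff_ne_zero μ hb hbv)) ?_
    exact ENNReal.mul_ne_top (ENNReal.inv_ne_top.2 hB1.measure_ne_zero)
      (measure_ne_top_of_subset Set.sdiff_subset hB1.measure_ne_top)
  have ht : Tendsto (fun θ : ℝ => 1 - absV b ^ θ) (𝓝[>] 0) (𝓝[>] 0) := by
    refine tendsto_nhdsWithin_iff.2 ⟨?_, ?_⟩
    · have := (Real.continuous_const_rpow hbp.ne').tendsto (0 : ℝ)
      have := (this.const_sub 1).mono_left (nhdsWithin_le_nhds (s := Set.Ioi 0))
      simpa using this
    · filter_upwards [self_mem_nhdsWithin] with θ hθ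
      exact sub_pos.2 (Real.rpow_lt_one hbp.le hb1 hθ)
  refine tendsto_nhds_top_mono
    (ENNReal.tendsto_ofReal_atTop.comp ((ht.inv_tendsto_nhdsGT_zero).const_mul_atTop hd)) ?_
  filter_upwards [Ioo_mem_nhdsGT one_pos] with θ hθ
  exact le_dualAverage μ hθ.1 hθ.2 hb hbv hb1

theorem exists_le_apChar_powerWeight (hp : 1 < p) : ∃ κ : ℝ≥0∞, κ ≠ 0 ∧
    ∀ θ : ℝ, 0 < θ → θ < 1 →
      κ * dualAverage μ θ ^ (p - 1) ≤ apChar μ p (powerWeight p θ : K → ℝ) := by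
  obtain ⟨b, hb, hbv, hb1⟩ := exists_absV_lt_one K
  have hp1 : 0 < p - 1 := by linarith
  have hbp := absV_pos hb
  have hB1 : IsBall (ball 0 (1 : K)) := isBall_ball 0 one_ne_zero
  refine ⟨(μ (ball 0 (1 : K)))⁻¹ *
    (ENNReal.ofReal (absV b ^ (p - 1)) * μ (ball 0 (1 : K) \ ball 0 b)), ?_, fun θ h0 h1 => ?_⟩
  · refine mul_ne_zero (ENNReal.inv_ne_zero.2 hB1.measure_ne_top)
      (mul_ne_zero ?_ (measure_ball_one_diff_ne_zero μ hb hbv))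
    simpa using Real.rpow_pos_of_pos hbp _
  · refine le_trans ?_ (apQuantity_le_apChar p (powerWeight p θ) hB1)
    rw [apQuantity_powerWeight μ hp, ← dualAverage]
    gcongr
    rw [← setLIntegral_const]
    refine (setLIntegral_mono (measurable_powerWeight p θ).ennreal_ofReal fun x hx => ?_).trans
      (lintegral_mono_set Set.sdiff_subset)
    refine ENNReal.ofReal_le_ofReal ?_
    calc absV b ^ (p - 1) ≤ absV b ^ ((p - 1) * (1 - θ)) :=
          Real.rpow_le_rpow_of_exponent_ge hbp hb1.le (by nlinarith)
      _ ≤ powerWeight p θ x := Real.rpow_le_rpow hbp.le (absV_le_of_notMem_ball hx.2)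
          (mul_nonneg hp1.le (by linarith))

theorem tendsto_apChar_powerWeight (hp : 1 < p) :
    Tendsto (fun θ : ℝ => apChar μ p (powerWeight p θ : K → ℝ)) (𝓝[>] 0) (𝓝 ∞) := by
  obtain ⟨κ, hκ, h⟩ := exists_le_apChar_powerWeight μ hp
  have hp1 : 0 < p - 1 := by linarith
  have h1 : Tendsto (fun θ => κ * dualAverage μ θ ^ (p - 1)) (𝓝[>] 0) (𝓝 ∞) := by
    have h2 : Tendsto (fun θ => dualAverage μ θ ^ (p - 1)) (𝓝[>] 0) (𝓝 ∞) := by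
      have := (ENNReal.continuous_rpow_const (y := p - 1)).tendsto ∞
      rw [ENNReal.top_rpow_of_pos hp1] at this
      exact this.comp (tendsto_dualAverage μ)
    have := ENNReal.Tendsto.const_mul (a := κ) h2 (Or.inl ENNReal.top_ne_zero)
    rwa [ENNReal.mul_top hκ] at this
  refine tendsto_nhds_top_mono h1 ?_
  filter_upwards [Ioo_mem_nhdsGT one_pos] with θ hθ using h θ hθ.1 hθ.2

theorem not_exists_maximalNorm_le (hp : 1 < p) {β : ℝ} (hβ : β < 1 / (p - 1)) :
    ¬ ∃ C : ℝ≥0, ∀ w : K → ℝ, IsAp μ p w → maximalNorm μ p w ≤ C * apChar μ p w ^ β := by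
  rintro ⟨C, hC⟩
  have hγ : 0 < 1 / (p - 1) - β := sub_pos.2 hβ
  have ht : Tendsto (fun θ : ℝ => apChar μ p (powerWeight p θ : K → ℝ) ^ (1 / (p - 1) - β))
      (𝓝[>] 0) (𝓝 ∞) := by
    have := (ENNReal.continuous_rpow_const (y := 1 / (p - 1) - β)).tendsto ∞
    rw [ENNReal.top_rpow_of_pos hγ] at this
    exact this.comp (tendsto_apChar_powerWeight μ hp)
  have hev := (ht.eventually (lt_mem_nhds (ENNReal.coe_lt_top (r := C)))).and
    (((tendsto_apChar_powerWeight μ hp).eventually (lt_mem_nhds ENNReal.zero_lt_top)).and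
      (Ioo_mem_nhdsGT one_pos))
  obtain ⟨θ, hθC, hθ0, hθ⟩ := hev.exists
  have hAp := isAp_powerWeight μ hp hθ.1 hθ.2
  set a := apChar μ p (powerWeight p θ : K → ℝ) with ha
  have hat : a ≠ ∞ := hAp.apChar_ne_top
  have hle : a ^ (1 / (p - 1) - β) * a ^ β ≤ C * a ^ β := by
    rw [← ENNReal.rpow_add _ _ hθ0.ne' hat, sub_add_cancel]
    exact (apChar_rpow_le_maximalNorm μ hp hθ.1 hθ.2).trans (hC _ hAp)
  rw [ENNReal.mul_le_mul_iff_left (ENNReal.rpow_pos hθ0 hat).ne'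
    (ENNReal.rpow_ne_top_of_ne_zero hθ0.ne' hat)] at hle
  exact not_le.2 hθC hle

end Power

end LocalFieldWeights

open LocalFieldWeights in
theorem theorem3p1 (p : ℝ) (hp : 1 < p) :
    -- the constants depend only on `p`
    ∃ C c : ℝ≥0, 0 < C ∧ 0 < c ∧
    ∀ (K : Type*) [Field K] [ValuativeRel K] [TopologicalSpace K] [IsNonarchimedeanLocalField K]
      [MeasurableSpace K] [BorelSpace K] (μ : Measure K) [μ.IsAddHaarMeasure],
      -- boundedness on `L^p(w)` with the bound on the norm
      (∀ w : K → ℝ, IsAp μ p w →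
        (∀ f : K → ℂ, MemWeighted μ p w f →
          LocallyIntegrable f μ ∧ MemWeighted μ p w (maximalFn μ f)) ∧
        maximalNorm μ p w ≤ C * apChar μ p w ^ (1 / (p - 1))) ∧
      -- the power weights and the functions for which the bound is attained up to a constant
      (∀ θ : ℝ, 0 < θ → θ < 1 →
        IsAp μ p (powerWeight p θ : K → ℝ) ∧
        MemWeighted μ p (powerWeight p θ) (extremalFn θ : K → ℂ) ∧
        0 < weightedNorm μ p (powerWeight p θ) (extremalFn θ : K → ℂ) ∧
        c * apChar μ p (powerWeight p θ : K → ℝ) ^ (1 / (p - 1)) *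
            weightedNorm μ p (powerWeight p θ) (extremalFn θ : K → ℂ) ≤
          weightedNorm μ p (powerWeight p θ) (maximalFn μ (extremalFn θ)) ∧
        c * apChar μ p (powerWeight p θ : K → ℝ) ^ (1 / (p - 1)) ≤
          maximalNorm μ p (powerWeight p θ : K → ℝ)) ∧
      Tendsto (fun θ : ℝ => apChar μ p (powerWeight p θ : K → ℝ)) (𝓝[>] 0) (𝓝 ∞) ∧
      -- the exponent `1 / (p - 1)` cannot be lowered
      (∀ β : ℝ, β < 1 / (p - 1) →
        ¬ ∃ C' : ℝ≥0, ∀ w : K → ℝ, IsAp μ p w → maximalNorm μ p w ≤ C' * apChar μ p w ^ β) := by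
  refine ⟨weightedConst p ^ (1 / p), 1, NNReal.rpow_pos (weightedConst_pos hp), one_pos, ?_⟩
  intro K _ _ _ _ _ _ μ _
  refine ⟨fun w hw => ⟨fun f hf => ⟨locallyIntegrable_of_memWeighted hp hw hf,
    memWeighted_maximalFn hp hw hf⟩, maximalNorm_le hp hw⟩, fun θ h0 h1 => ?_,
    tendsto_apChar_powerWeight μ hp, fun β hβ => not_exists_maximalNorm_le μ hp hβ⟩
  rw [ENNReal.coe_one, one_mul]
  exact ⟨isAp_powerWeight μ hp h0 h1, memWeighted_extremalFn μ hp h0 h1,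
    weightedNorm_extremalFn_pos μ hp h1, apChar_mul_weightedNorm_le μ hp h1,
    apChar_rpow_le_maximalNorm μ hp h0 h1⟩
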